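/- Identify an ordinal with the set of its predecessors and a cardinal with its initial ordinal. \textbf{Trees.} Let $\kappa$ be a regular uncountable cardinal. A poset $\mathbf T=(T,<_T)$ is a \emph{$\kappa$-tree} if for every $x\in T$ the set $x_\downarrow=\{y\in T\mid y<_T x\}$ is well-ordered by $<_T$ (its order type is the height $\mathrm{ht}(x)$), for every $\alpha<\kappa$ the level $T_\alpha=\{x\in T\mid \mathrm{ht}(x)=\alpha\}$ is nonempty of size $<\kappa$, and $T_\kappa=\emptyset$. An \emph{$\alpha$-branch} is a linearly ordered $B\subseteq T$ with $\{\mathrm{ht}(x)\mid x\in B\}=\alpha$; it is \emph{vanishing} if it has no upper bound in $\mathbf T$. A $\kappa$-tree is \emph{full} if for every (nonzero) limit ordinal $\alpha<\kappa$ it has at most one vanishing $\alpha$-branch; \emph{normal} if for all $\bar\alpha<\alpha<\kappa$ every $x\in T_{\bar\alpha}$ lies below some $y\in T_\alpha$; and \emph{$\kappa$-Souslin} if it has no $\kappa$-branch and no antichain (set of pairwise incomparable nodes) of size $\kappa$. Let $H_\kappa$ be the collection of all sets of hereditary cardinality less than $\kappa$. A \emph{streamlined $\kappa$-tree} is a set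 $T\subseteq{}^{<\kappa}H_\kappa$ of functions from ordinals below $\kappa$ to $H_\kappa$, such that $t\restriction\alpha\in T$ for all $t\in T$ and $\alpha<\kappa$, and such that for every $\alpha<\kappa$ the set $T_\alpha=T\cap{}^{\alpha}H_\kappa$ is nonempty and has size $<\kappa$; it is identified with the $\kappa$-tree $(T,\subset)$. It is \emph{prolific} if $t{}^\smallfrown\langle i\rangle\in T$ for all $\alpha<\kappa$, $t\in T_\alpha$ and $i<\max\{\omega,\alpha\}$. \textbf{Diamond for trees.} For $S\subseteq E^\kappa_{>\omega}:=\{\alpha<\kappa\mid \mathrm{cf}(\alpha)>\omega\}$, the principle $\diamondsuit^*_S(\kappa\text{-trees})$ asserts that there is a sequence $\langle f_\beta\mid\beta<\kappa\rangle$ such that for every streamlined $\kappa$-tree $T$ there is a club $D\subseteq\kappa$ such that for every $\alpha\in S\cap D$ and every $f\in T_\alpha$ the set $\{\beta<\alpha\mid f\restriction\beta=f_\beta\}$ is stationary in $\alpha$. \textbf{Proxy principle.} For a set $C$ of ordinals let $\mathrm{acc}(C)=\{\alpha\in C\mid \sup(C\cap\alpha)=\alpha>0\}$ and $\mathrm{nacc}(C)=C\setminus\mathrm{acc}(C)$.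 Write $D\sqsubseteq C$ if $D=C\cap\beta$ for some ordinal $\beta$, and $D\sqsubseteq^* C$ if $D\setminus\varepsilon\sqsubseteq C\setminus\varepsilon$ for some $\varepsilon<\sup(D)$. The principle $\mathrm P^-(\kappa,2,\sqsubseteq^*,1,\{S\})$ asserts that there is a sequence $\langle C_\alpha\mid\alpha<\kappa\rangle$ such that each $C_\alpha$ is a closed subset of $\alpha$ with $\sup(C_\alpha)=\sup(\alpha)$; such that $C_\beta\sqsubseteq^* C_\alpha$ whenever $\beta<\alpha<\kappa$ and $\beta\in\mathrm{acc}(C_\alpha)$; and such that for every cofinal $B\subseteq\kappa$ there are stationarily many nonzero $\alpha\in S$ with $\sup(\mathrm{nacc}(C_\alpha)\cap B)=\alpha$. \textbf{Theorem.} Suppose that $\kappa$ is a strongly inaccessible cardinal, that $S\subseteq E^\kappa_{>\omega}$ is stationary in $\kappa$, that $\diamondsuit^*_S(\kappa\text{-trees})$ holds, and that $\mathrm P^-(\kappa,2,\sqsubseteq^*,1,\{S\})$ holds. Then there exists a streamlined, normal, prolific, full $\kappa$-Souslin tree. -/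

import Mathlib

universe u v

namespace FullSouslin

open Set Cardinal

/-! ## Clubs, stationary sets, accumulation points

An ordinal `α` is identified with the set `Set.Iio α` of its predecessors, and a cardinal `κ` with
its initial ordinal `κ.ord`. -/

/-- `D` is a closed and unbounded subset of the ordinal `α`. -/
def IsClubIn (D : Set Ordinal.{u}) (α : Ordinal.{u}) : Prop :=
  D ⊆ Iio α ∧ IsClub ((↑) ⁻¹' D : Set (Iio α))

/-- `S` is a stationary subset of the ordinal `α`. -/
def IsStationaryIn (S : Set Ordinal.{u}) (α : Ordinal.{u}) : Prop :=
  S ⊆ Iio α ∧ IsStationary ((↑) ⁻¹' S : Set (Iio α))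

/-- `E^κ_{>ω}`: the ordinals below `κ` of uncountable cofinality. -/
def uncountableCof (κ : Cardinal.{u}) : Set Ordinal.{u} :=
  {α | α < κ.ord ∧ ℵ₀ < α.cof}

/-- `acc(C) = {α ∈ C | sup(C ∩ α) = α > 0}`. -/
def acc (C : Set Ordinal.{u}) : Set Ordinal.{u} :=
  {α | α ∈ C ∧ sSup (C ∩ Iio α) = α ∧ 0 < α}

/-- `nacc(C) = C \ acc(C)`. -/
def nacc (C : Set Ordinal.{u}) : Set Ordinal.{u} := C \ acc C

/-! ## Abstract trees -/

section Trees

variable (κ : Cardinal.{u}) (T : Type v) [PartialOrder T]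

variable {T} in
/-- The set of strict predecessors of `x` has order type `α`. -/
def HasHeight (x : T) (α : Ordinal.{u}) : Prop := Nonempty (Iio x ≃o Iio α)

/-- The `α`-th level `T_α` of a tree. -/
def level (α : Ordinal.{u}) : Set T := {x | HasHeight x α}

/-- `(T, <)` is a `κ`-tree. -/
structure IsKappaTree : Prop where
  wellOrdered : ∀ x : T, IsWellOrder (Iio x) (· < ·)
  level_nonempty : ∀ α < κ.ord, (level T α).Nonempty
  level_small : ∀ α < κ.ord, lift.{u} #(level T α) < lift.{v} κ
  level_kappa : level T κ.ord = ∅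

variable {T} in
/-- `B` is an `α`-branch: it is linearly ordered, and the set of heights of its elements is `α`. -/
structure IsBranch (B : Set T) (α : Ordinal.{u}) : Prop where
  isChain : IsChain (· ≤ ·) B
  height_lt : ∀ x ∈ B, ∃ β < α, HasHeight x β
  exists_height : ∀ β < α, ∃ x ∈ B, HasHeight x β

variable {T} in
/-- A set of nodes is vanishing if it has no upper bound in the tree. -/
def IsVanishing (B : Set T) : Prop := ¬ ∃ y : T, ∀ x ∈ B, x ≤ y

/-- At every limit `α < κ` there is at most one vanishing `α`-branch. -/
def IsFull : Prop :=
  ∀ α < κ.ord, Order.IsSuccLimit α → ∀ B B' : Set T,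
    IsBranch B α → IsVanishing B → IsBranch B' α → IsVanishing B' → B = B'

/-- Every node has an extension at every higher level below `κ`. -/
def IsNormalTree : Prop :=
  ∀ α < κ.ord, ∀ α' < α, ∀ x ∈ level T α', ∃ y ∈ level T α, x < y

/-- A `κ`-tree with no `κ`-branches and no antichains of size `κ`. -/
structure IsSouslin : Prop where
  isKappaTree : IsKappaTree κ T
  no_branch : ¬ ∃ B : Set T, IsBranch B κ.ord
  no_antichain : ¬ ∃ A : Set T, IsAntichain (· ≤ ·) A ∧ lift.{u} #A = lift.{v} κ

end Trees

/-! ## Transfinite sequences and streamlined trees -/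

/-- A transfinite sequence of sets: a function whose domain is an ordinal. -/
structure TSeq : Type (u + 1) where
  /-- The domain. -/
  len : Ordinal.{u}
  /-- The values. -/
  val : Iio len → ZFSet.{u}

namespace TSeq

/-- Sequences are ordered by end-extension, that is, by inclusion of their graphs. -/
instance : PartialOrder TSeq.{u} where
  le s t := ∃ h : s.len ≤ t.len, ∀ β (hβ : β < s.len), s.val ⟨β, hβ⟩ = t.val ⟨β, hβ.trans_le h⟩
  le_refl s := ⟨le_rfl, fun _ _ => rfl⟩
  le_trans := by
    rintro s t r ⟨h₁, e₁⟩ ⟨h₂, e₂⟩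
    exact ⟨h₁.trans h₂, fun β hβ => (e₁ β hβ).trans (e₂ β (hβ.trans_le h₁))⟩
  le_antisymm := by
    rintro ⟨a, f⟩ ⟨b, g⟩ ⟨h₁, e₁⟩ ⟨h₂, _⟩
    obtain rfl : a = b := le_antisymm h₁ h₂
    obtain rfl : f = g := funext fun ⟨β, hβ⟩ => e₁ β hβ
    rfl

/-- The restriction `t ↾ α`, with domain `dom(t) ∩ α`. -/
noncomputable def restrict (t : TSeq.{u}) (α : Ordinal.{u}) : TSeq.{u} where
  len := min t.len α
  val β := t.val ⟨β.1, (lt_min_iff.1 (mem_Iio.1 β.2)).1⟩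

open Classical in
/-- `t ⌢ ⟨a⟩`. -/
noncomputable def concat (t : TSeq.{u}) (a : ZFSet.{u}) : TSeq.{u} where
  len := t.len + 1
  val β := if h : β.1 < t.len then t.val ⟨β.1, h⟩ else a

end TSeq

/-- `H_κ`: the sets of hereditary cardinality less than `κ`. -/
def hereditary (κ : Cardinal.{u}) : Set ZFSet.{u} :=
  {x | x.Hereditarily fun y => y.card < κ}

/-- `T ∩ ^α H_κ`, for a set `T` of `H_κ`-valued sequences. -/
def seqLevel (T : Set TSeq.{u}) (α : Ordinal.{u}) : Set TSeq.{u} := {t | t ∈ T ∧ t.len = α}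

/-- `T` is a streamlined `κ`-tree. As a poset it is `T` with the order of end-extension. -/
structure IsStreamlined (κ : Cardinal.{u}) (T : Set TSeq.{u}) : Prop where
  /-- `T` consists of functions from ordinals below `κ` to `H_κ`. -/
  len_lt : ∀ t ∈ T, t.len < κ.ord
  val_mem : ∀ t ∈ T, ∀ β, t.val β ∈ hereditary κ
  restrict_mem : ∀ t ∈ T, ∀ α < κ.ord, t.restrict α ∈ T
  level_nonempty : ∀ α < κ.ord, (seqLevel T α).Nonempty
  level_small : ∀ α < κ.ord, #(seqLevel T α) < lift.{u + 1} κ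

/-- For all `α < κ`, `t ∈ T_α` and `i < max{ω, α}`, the sequence `t ⌢ ⟨i⟩` is in `T`. -/
def IsProlific (κ : Cardinal.{u}) (T : Set TSeq.{u}) : Prop :=
  ∀ α < κ.ord, ∀ t ∈ seqLevel T α, ∀ i < max Ordinal.omega0 α, t.concat i.toZFSet ∈ T

/-! ## Diamond for trees -/

/-- The principle `◊*_{S,B}(κ-trees)`. -/
def DiamondStarTrees (κ : Cardinal.{u}) (S B : Set Ordinal.{u}) : Prop :=
  ∃ f : Ordinal.{u} → TSeq.{u}, ∀ T : Set TSeq.{u}, IsStreamlined κ T →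
    ∃ D, IsClubIn D κ.ord ∧ ∀ α ∈ S ∩ D, ∀ t ∈ seqLevel T α,
      IsStationaryIn {β | β ∈ B ∩ Iio α ∧ t.restrict β = f β} α

/-! ## The proxy principle -/

/-- `C` is a `C`-sequence over `κ`: for each `α < κ`, `C α` is a closed subset of `α` with
`sup (C α) = sup α`. -/
def IsCSequence (κ : Cardinal.{u}) (C : Ordinal.{u} → Set Ordinal.{u}) : Prop :=
  ∀ α < κ.ord, C α ⊆ Iio α ∧
    (∀ β < α, 0 < β → sSup (C α ∩ Iio β) = β → β ∈ C α) ∧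
    sSup (C α) = sSup (Iio α)

/-- `R`-coherence of a `C`-sequence over `κ`. -/
def IsCoherent (κ : Cardinal.{u}) (R : Set Ordinal.{u} → Set Ordinal.{u} → Prop)
    (C : Ordinal.{u} → Set Ordinal.{u}) : Prop :=
  ∀ α < κ.ord, ∀ β < α, β ∈ acc (C α) → R (C β) (C α)

/-- `D ⊑ C`. -/
def InitialIn (D C : Set Ordinal.{u}) : Prop := ∃ β, D = C ∩ Iio β

/-- `D ⊑* C`: `D \ ε ⊑ C \ ε` for some `ε < sup D`. -/
def AlmostInitialIn (D C : Set Ordinal.{u}) : Prop :=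
  ∃ ε < sSup D, InitialIn (D \ Iio ε) (C \ Iio ε)

/-- `B` is a cofinal subset of `κ`. -/
def IsCofinalIn (B : Set Ordinal.{u}) (κ : Cardinal.{u}) : Prop :=
  B ⊆ Iio κ.ord ∧ ∀ α < κ.ord, ∃ β ∈ B, α ≤ β

/-- The proxy principle `P⁻(κ, 2, R, θ, 𝒮)`. -/
def ProxyMinus (κ : Cardinal.{u}) (R : Set Ordinal.{u} → Set Ordinal.{u} → Prop)
    (θ : Cardinal.{u}) (𝒮 : Set (Set Ordinal.{u})) : Prop :=
  ∃ C : Ordinal.{u} → Set Ordinal.{u}, IsCSequence κ C ∧ IsCoherent κ R C ∧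
    ∀ B : Ordinal.{u} → Set Ordinal.{u}, (∀ i < θ.ord, IsCofinalIn (B i) κ) →
      ∀ S ∈ 𝒮, IsStationaryIn
        {α | α ∈ S ∧ ∀ i < min α θ.ord, sSup (nacc (C α) ∩ B i) = α} κ.ord

end FullSouslin

namespace FullSouslin

open Set Cardinal

/-! ## Ordinals below a limit of uncountable cofinality -/

/-! The tree is built by recursion on levels inside the tree of all sequences whose `β`-th value is
an ordinal below `max ω β`. At a limit `α` every branch receives an upper bound, with one possible
exception: the branch given by `F α` is left out if its union properly extends no element of `G α`
and no tail of it climbs along `C α`. Fullness is then immediate (`eq_of_isVanishing`). Normality is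
the first issue: any node on `C α` can climb along `C α`, and the unions on the way are kept, since
at an accumulation point `δ` of `C α` coherence makes a tail of the climb a climb along `C δ`
(`exists_climbs`, `exists_extension`).

The Souslin property reduces to `exists_level_meets`: for a dense `U`, all nodes of some level
properly extend elements of `U`. Inaccessibility lets a node together with a subset of the tree be
coded as a node of another streamlined tree, so the diamond guesses both at once
(`DiamondStarTrees.exists_guess`). The proxy principle supplies `α` such that `nacc (C α)` is
cofinally often at levels where `G` guesses `U` correctly. For `t` of level `α`, uncountable
cofinality gives a limit `β` of such levels with `F β` equal to `t` cut at `β` and `G β` correct. As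
this restriction was admitted, it either meets `G β`, hence `U`, or climbs along `C β`; in the
second case one of its steps occurs at a good level, and the choice made by `nextNode` meets `U`
there. -/

theorem isClub_closedUnder {l η : Ordinal.{u}} (hcof : ℵ₀ < l.cof) (hη : η < l)
    {h : Ordinal.{u} → Ordinal.{u}} (hmap : ∀ δ < l, h δ < l)
    (hmono : ∀ δ δ', δ ≤ δ' → δ' < l → h δ ≤ h δ') :
    IsClub ({β | η < β.1 ∧ ∀ δ < β.1, h δ < β.1 ∧ δ + 1 < β.1} : Set (Iio l)) := by
  have hlim : Order.IsSuccLimit l := Ordinal.one_lt_cof_iff.1 (one_lt_aleph0.trans hcof)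
  constructor
  · intro X hX hne _ b hb
    have key : ∀ δ < b.1, ∃ x ∈ X, δ < x.1 := by
      intro δ hδ
      by_contra! hcon
      have : b ≤ ⟨δ, hδ.trans b.2⟩ := hb.2 fun x hx => hcon x hx
      exact absurd hδ (not_lt.2 this)
    obtain ⟨x, hx⟩ := hne
    refine ⟨(hX hx).1.trans_le (hb.1 hx), fun δ hδ => ?_⟩
    obtain ⟨y, hy, hδy⟩ := key δ hδ
    exact ⟨((hX hy).2 δ hδy).1.trans_le (hb.1 hy), ((hX hy).2 δ hδy).2.trans_le (hb.1 hy)⟩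
  · rintro ⟨a, ha⟩
    -- Iterating `h` countably often stays below `l` by uncountable cofinality; the successors make
    -- the supremum a limit, and monotonicity transfers the bound from `g n` to everything below it.
    let g : ℕ → Ordinal.{u} := fun n => Nat.rec (max a η + 1) (fun _ x => max (h x) x + 1) n
    have hg : ∀ n, g n < l := by
      intro n
      induction n with
      | zero => exact hlim.add_one_lt (max_lt ha hη)
      | succ n ih => exact hlim.add_one_lt (max_lt (hmap _ ih) ih)
    have hbdd : BddAbove (range g) := ⟨l, by rintro _ ⟨n, rfl⟩; exact (hg n).le⟩
    have hle : ∀ n, g n ≤ ⨆ n, g n := fun n => le_ciSup hbdd n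
    have hsup : ⨆ n, g n < l := by
      apply Ordinal.lift_iSup_lt_of_lt_cof _ hg
      simpa using hcof
    have h0 : max a η < ⨆ n, g n := (Order.lt_add_one_iff.2 le_rfl).trans_le (hle 0)
    refine ⟨⟨_, hsup⟩, ⟨(le_max_right _ _).trans_lt h0, fun δ hδ => ?_⟩,
      ((le_max_left _ _).trans_lt h0).le⟩
    obtain ⟨n, hn⟩ := exists_lt_of_lt_ciSup hδ
    have h1 : g (n + 1) = max (h (g n)) (g n) + 1 := rfl
    have h2 : max (h (g n)) (g n) < ⨆ n, g n := by
      refine lt_of_lt_of_le ?_ (hle (n + 1))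
      rw [h1]; exact Order.lt_add_one_iff.2 le_rfl
    refine ⟨((hmono _ _ hn.le (hg n)).trans (le_max_left _ _)).trans_lt h2, ?_⟩
    exact (Order.add_one_le_of_lt hn).trans_lt ((le_max_right _ _).trans_lt h2)

/-- The form in which stationarity is used below: closure under `h` is a club condition, and
uncountable cofinality lets it be intersected with `D`. -/
theorem IsStationaryIn.exists_closedUnder {l η : Ordinal.{u}} {X D : Set Ordinal.{u}}
    (hX : IsStationaryIn X l) (hD : IsClubIn D l) (hcof : ℵ₀ < l.cof) (hη : η < l)
    {h : Ordinal.{u} → Ordinal.{u}} (hmap : ∀ δ < l, h δ < l)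
    (hmono : ∀ δ δ', δ ≤ δ' → δ' < l → h δ ≤ h δ') :
    ∃ β ∈ X, β ∈ D ∧ β < l ∧ η < β ∧ ∀ δ < β, h δ < β ∧ δ + 1 < β := by
  have hne : Order.cof (Iio l) ≠ ℵ₀ := by
    rw [Ordinal.cof_Iio, ← Ordinal.lift_cof]
    intro h0
    rw [lift_eq_aleph0] at h0
    exact hcof.ne' h0
  obtain ⟨⟨β, hβ⟩, h1, h2, h3⟩ := hX.2 (hD.2.inter hne (isClub_closedUnder hcof hη hmap hmono))
  exact ⟨β, h1, h2, hβ, h3.1, h3.2⟩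

theorem isClubIn_Iio (l : Ordinal.{u}) : IsClubIn (Iio l) l := by
  refine ⟨le_rfl, ?_⟩
  have : ((↑) ⁻¹' Iio l : Set (Iio l)) = Set.univ := by ext x; simp
  rw [this]; exact .univ

/-! ## Accumulation points of closed sets -/

theorem sSup_inter_Iio_le (C : Set Ordinal.{u}) (γ : Ordinal.{u}) : sSup (C ∩ Iio γ) ≤ γ :=
  csSup_le' fun _ hx => hx.2.le

theorem le_sSup_inter_Iio {C : Set Ordinal.{u}} {γ δ : Ordinal.{u}} (h : δ ∈ C) (hδ : δ < γ) :
    δ ≤ sSup (C ∩ Iio γ) :=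
  le_csSup ⟨γ, fun _ hx => hx.2.le⟩ ⟨h, hδ⟩

theorem sSup_inter_Iio_eq_iff {C : Set Ordinal.{u}} {γ : Ordinal.{u}} :
    sSup (C ∩ Iio γ) = γ ↔ ∀ δ < γ, ∃ c ∈ C, δ < c ∧ c < γ := by
  constructor
  · intro h δ hδ
    by_contra! hcon
    refine absurd hδ (not_lt.2 ?_)
    rw [← h]
    refine csSup_le' fun c hc => ?_
    by_contra! hlt
    exact absurd hc.2 (not_lt.2 (hcon c hc.1 hlt))
  · intro h
    refine (sSup_inter_Iio_le C γ).antisymm (le_of_forall_lt fun δ hδ => ?_)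
    obtain ⟨c, hc, hδc, hcγ⟩ := h δ hδ
    exact hδc.trans_le (le_sSup_inter_Iio hc hcγ)

theorem mem_acc {C : Set Ordinal.{u}} {γ : Ordinal.{u}} :
    γ ∈ acc C ↔ γ ∈ C ∧ (∀ δ < γ, ∃ c ∈ C, δ < c ∧ c < γ) ∧ 0 < γ := by
  simp only [acc, mem_ofPred_eq, sSup_inter_Iio_eq_iff]

theorem isSuccLimit_of_unbounded {C : Set Ordinal.{u}} {γ : Ordinal.{u}} (h0 : 0 < γ)
    (h : ∀ δ < γ, ∃ c ∈ C, δ < c ∧ c < γ) : Order.IsSuccLimit γ := by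
  refine Ordinal.isSuccLimit_iff.2 ⟨h0.ne', Order.isSuccPrelimit_of_succ_lt fun δ hδ => ?_⟩
  obtain ⟨c, -, h1, h2⟩ := h δ hδ
  exact (Order.add_one_le_of_lt h1).trans_lt h2

theorem sSup_inter_Iio_lt_of_mem_nacc {C : Set Ordinal.{u}} {γ : Ordinal.{u}} (h : γ ∈ nacc C)
    (h0 : 0 < γ) : sSup (C ∩ Iio γ) < γ :=
  (sSup_inter_Iio_le C γ).lt_of_ne fun he => h.2 ⟨h.1, he, h0⟩

theorem IsCSequence.unbounded {κ : Cardinal.{u}} {C : Ordinal.{u} → Set Ordinal.{u}}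
    (hC : IsCSequence κ C) {α : Ordinal.{u}} (hα : α < κ.ord) (hlim : Order.IsSuccLimit α) :
    ∀ δ < α, ∃ c ∈ C α, δ < c ∧ c < α := by
  obtain ⟨h1, -, h2⟩ := hC α hα
  rw [← sSup_inter_Iio_eq_iff, inter_eq_self_of_subset_left h1, h2]
  have := @sSup_inter_Iio_eq_iff Set.univ α
  rw [univ_inter] at this
  rw [this]
  intro δ hδ
  exact ⟨δ + 1, trivial, Order.lt_add_one_iff.2 le_rfl, hlim.add_one_lt hδ⟩

/-- The elements of `D` and `C` agree between `ε` and `β`. -/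
theorem AlmostInitialIn.exists_agree {C D : Set Ordinal.{u}} {β : Ordinal.{u}}
    (h : AlmostInitialIn D C) (hD : D ⊆ Iio β) (hDu : ∀ δ < β, ∃ c ∈ D, δ < c ∧ c < β) :
    ∃ ε < β, ∀ γ < β, ε ≤ γ → (γ ∈ D ↔ γ ∈ C) := by
  obtain ⟨ε, hε, δ, hδ⟩ := h
  have hsup : sSup D ≤ β := csSup_le' fun x hx => (hD hx).le
  have hεβ := hε.trans_le hsup
  have mem : ∀ γ, ε ≤ γ → (γ ∈ D ↔ γ ∈ C ∧ γ < δ) := by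
    intro γ hγ
    have := Set.ext_iff.1 hδ γ
    simpa [hγ] using this
  -- The initial segment cannot be cut below `β`, because `D` is unbounded in `β`.
  have hβδ : β ≤ δ := by
    by_contra! hlt
    obtain ⟨c, hc, h1, -⟩ := hDu _ (max_lt hlt hεβ)
    have := ((mem c ((le_max_right _ _).trans h1.le)).1 hc).2
    exact absurd this (not_lt.2 ((le_max_left _ _).trans h1.le))
  exact ⟨ε, hεβ, fun γ hγ hεγ => by rw [mem γ hεγ]; simp [hγ.trans_le hβδ]⟩

/-- Past some point, `D` and `C` have the same non-accumulation points below `β`, with the same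
predecessors. -/
theorem AlmostInitialIn.exists_agree_nacc {C D : Set Ordinal.{u}} {β : Ordinal.{u}}
    (h : AlmostInitialIn D C) (hD : D ⊆ Iio β) (hDu : ∀ δ < β, ∃ c ∈ D, δ < c ∧ c < β) :
    ∃ ε < β, ∀ γ < β, ε < γ →
      (γ ∈ nacc D ↔ γ ∈ nacc C) ∧ sSup (D ∩ Iio γ) = sSup (C ∩ Iio γ) := by
  obtain ⟨ε, hε, hag⟩ := h.exists_agree hD hDu
  -- Above a common point `c` of the two sets, both suprema are at least `c`, so they depend only on
  -- the part where the sets agree.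
  obtain ⟨c, hc, hεc, hcβ⟩ := hDu ε hε
  refine ⟨c, hcβ, fun γ hγ hcγ => ?_⟩
  have hs : sSup (D ∩ Iio γ) = sSup (C ∩ Iio γ) := by
    apply le_antisymm
    · refine csSup_le' fun x hx => ?_
      rcases le_total x c with hxc | hxc
      · exact hxc.trans (le_sSup_inter_Iio ((hag c hcβ hεc.le).1 hc) hcγ)
      · exact le_sSup_inter_Iio ((hag x (hx.2.trans hγ) (hεc.le.trans hxc)).1 hx.1) hx.2
    · refine csSup_le' fun x hx => ?_
      rcases le_total x c with hxc | hxc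
      · exact hxc.trans (le_sSup_inter_Iio hc hcγ)
      · exact le_sSup_inter_Iio ((hag x (hx.2.trans hγ) (hεc.le.trans hxc)).2 hx.1) hx.2
  refine ⟨?_, hs⟩
  simp only [nacc, acc, mem_sdiff, mem_ofPred_eq, hs, hag γ hγ (hεc.trans hcγ).le]

/-! ## Transfinite sequences -/

namespace TSeq

open Classical in
/-- The value of a sequence at an arbitrary ordinal, with default value `∅`. -/
noncomputable def app (t : TSeq.{u}) (β : Ordinal.{u}) : ZFSet.{u} :=
  if h : β < t.len then t.val ⟨β, h⟩ else ∅

/-- The sequence of length `α` with values given by `f`. -/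
def ofFun (α : Ordinal.{u}) (f : Ordinal.{u} → ZFSet.{u}) : TSeq.{u} := ⟨α, fun β => f β.1⟩

theorem app_of_lt {t : TSeq.{u}} {β : Ordinal.{u}} (h : β < t.len) : t.app β = t.val ⟨β, h⟩ :=
  dif_pos h

@[simp] theorem len_ofFun (α : Ordinal.{u}) (f) : (ofFun α f).len = α := rfl

theorem app_ofFun {α β : Ordinal.{u}} (f) (h : β < α) : (ofFun α f).app β = f β :=
  app_of_lt (t := ofFun α f) h

theorem le_iff {s t : TSeq.{u}} : s ≤ t ↔ s.len ≤ t.len ∧ ∀ β < s.len, s.app β = t.app β := by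
  constructor
  · rintro ⟨h, e⟩
    exact ⟨h, fun β hβ => by rw [app_of_lt hβ, app_of_lt (hβ.trans_le h)]; exact e β hβ⟩
  · rintro ⟨h, e⟩
    exact ⟨h, fun β hβ => by
      rw [← app_of_lt hβ, ← app_of_lt (hβ.trans_le h)]; exact e β hβ⟩

theorem ext_app {s t : TSeq.{u}} (hl : s.len = t.len) (h : ∀ β < s.len, s.app β = t.app β) :
    s = t :=
  le_antisymm (le_iff.2 ⟨hl.le, h⟩) (le_iff.2 ⟨hl.ge, fun β hβ => (h β (hl ▸ hβ)).symm⟩)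

@[simp] theorem len_restrict (t : TSeq.{u}) (α) : (t.restrict α).len = min t.len α := rfl

theorem len_restrict_of_le {t : TSeq.{u}} {α} (h : α ≤ t.len) : (t.restrict α).len = α :=
  min_eq_right h

theorem app_restrict (t : TSeq.{u}) {α β : Ordinal.{u}} (h : β < α) :
    (t.restrict α).app β = t.app β := by
  by_cases hβ : β < t.len
  · rw [app_of_lt hβ, app_of_lt (t := t.restrict α) (lt_min hβ h)]; rfl
  · rw [app, app, dif_neg hβ, dif_neg]
    exact fun h' => hβ (h'.trans_le (min_le_left _ _))

theorem restrict_of_le {t : TSeq.{u}} {α} (h : t.len ≤ α) : t.restrict α = t :=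
  ext_app (min_eq_left h) fun _ hβ => app_restrict t
    ((lt_of_lt_of_le hβ (min_le_right _ _)))

theorem restrict_le (t : TSeq.{u}) (α) : t.restrict α ≤ t :=
  le_iff.2 ⟨min_le_left _ _, fun _ hβ => app_restrict t (lt_of_lt_of_le hβ (min_le_right _ _))⟩

theorem restrict_restrict (t : TSeq.{u}) {α β : Ordinal.{u}} (h : β ≤ α) :
    (t.restrict α).restrict β = t.restrict β := by
  refine ext_app (by simp [min_assoc, h]) fun γ hγ => ?_
  have hγ : γ < β := lt_of_lt_of_le hγ (min_le_right _ _)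
  rw [app_restrict _ hγ, app_restrict _ hγ, app_restrict _ (hγ.trans_le h)]

theorem le_iff_restrict {s t : TSeq.{u}} : s ≤ t ↔ s.len ≤ t.len ∧ t.restrict s.len = s := by
  refine ⟨fun h => ⟨h.1, ?_⟩, fun h => h.2 ▸ restrict_le t _⟩
  refine ext_app (len_restrict_of_le h.1) fun β hβ => ?_
  rw [len_restrict_of_le h.1] at hβ
  rw [app_restrict _ hβ, (le_iff.1 h).2 β hβ]

theorem restrict_len_of_le {s t : TSeq.{u}} (h : s ≤ t) : t.restrict s.len = s :=
  (le_iff_restrict.1 h).2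

theorem len_mono {s t : TSeq.{u}} (h : s ≤ t) : s.len ≤ t.len := h.1

theorem eq_of_le_of_len {s t : TSeq.{u}} (h : s ≤ t) (hl : t.len ≤ s.len) : s = t :=
  ext_app (h.1.antisymm hl) (le_iff.1 h).2

theorem len_lt {s t : TSeq.{u}} (h : s < t) : s.len < t.len :=
  h.le.1.lt_of_not_ge fun hl => h.ne (eq_of_le_of_len h.le hl)

theorem restrict_lt {t : TSeq.{u}} {α} (h : α < t.len) : t.restrict α < t :=
  (restrict_le t α).lt_of_ne fun he => by
    have := congrArg len he
    rw [len_restrict_of_le h.le] at this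
    exact h.ne this

theorem restrict_mono_left {s t : TSeq.{u}} (h : s ≤ t) {α} (hα : α ≤ s.len) :
    s.restrict α = t.restrict α := by
  rw [← restrict_len_of_le h, restrict_restrict _ hα]

theorem restrict_mono (t : TSeq.{u}) {α β : Ordinal.{u}} (h : α ≤ β) :
    t.restrict α ≤ t.restrict β := by
  rw [← restrict_restrict t h]; exact restrict_le _ _

/-- Two initial segments of the same sequence are comparable. -/
theorem le_of_le_of_len {r s t : TSeq.{u}} (h : r ≤ t) (h' : s ≤ t) (hl : r.len ≤ s.len) :
    r ≤ s := by
  rw [← restrict_len_of_le h, ← restrict_len_of_le h']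
  exact restrict_mono t hl

theorem eq_of_restrict_eq {s t : TSeq.{u}} (hl : s.len = t.len)
    (h : ∀ δ < s.len, ∃ γ, δ < γ ∧ s.restrict γ = t.restrict γ) : s = t :=
  ext_app hl fun δ hδ => by
    obtain ⟨γ, h1, h2⟩ := h δ hδ
    rw [← app_restrict s h1, h2, app_restrict t h1]

@[simp] theorem len_concat (t : TSeq.{u}) (a) : (t.concat a).len = t.len + 1 := rfl

theorem app_concat_len (t : TSeq.{u}) (a) : (t.concat a).app t.len = a := by
  rw [app_of_lt (t := t.concat a) (Order.lt_add_one_iff.2 le_rfl)]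
  exact dif_neg (lt_irrefl _)

theorem app_concat_of_lt (t : TSeq.{u}) (a) {β : Ordinal.{u}} (h : β < t.len) :
    (t.concat a).app β = t.app β := by
  rw [app_of_lt h, app_of_lt (t := t.concat a) (h.trans (Order.lt_add_one_iff.2 le_rfl))]
  exact dif_pos h

theorem le_concat (t : TSeq.{u}) (a) : t ≤ t.concat a :=
  le_iff.2 ⟨(Order.lt_add_one_iff.2 le_rfl).le, fun _ h => (app_concat_of_lt t a h).symm⟩

/-- A coherent system of sequences of cofinally many lengths has a union. -/
theorem exists_union {α : Ordinal.{u}} {X : Set TSeq.{u}} (hX : ∀ s ∈ X, s.len < α)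
    (hcof : ∀ δ < α, ∃ s ∈ X, δ < s.len)
    (hchain : ∀ s ∈ X, ∀ t ∈ X, s ≤ t ∨ t ≤ s) :
    ∃ t : TSeq.{u}, t.len = α ∧ ∀ s ∈ X, s ≤ t := by
  have : Nonempty TSeq.{u} := ⟨ofFun 0 fun _ => ∅⟩
  choose! f hf hfl using hcof
  refine ⟨ofFun α fun δ => (f δ).app δ, rfl, fun s hs => ?_⟩
  refine le_iff.2 ⟨(hX s hs).le, fun β hβ => ?_⟩
  have hβα := hβ.trans (hX s hs)
  rw [app_ofFun _ hβα]
  rcases hchain s hs _ (hf β hβα) with h | h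
  · exact (le_iff.1 h).2 β hβ
  · exact ((le_iff.1 h).2 β (hfl β hβα)).symm

end TSeq

/-! ## Trees of sequences of ordinals -/

theorem toZFSet_mem_hereditary {κ : Cardinal.{u}} {i : Ordinal.{u}} (hi : i < κ.ord) :
    i.toZFSet ∈ hereditary κ := by
  induction i using WellFoundedLT.induction with
  | ind i ih =>
    refine ZFSet.hereditarily_iff.2 ⟨?_, fun y hy => ?_⟩
    · rw [Ordinal.card_toZFSet]; exact lt_ord.1 hi
    · obtain ⟨a, ha, rfl⟩ := Ordinal.mem_toZFSet_iff.1 hy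
      exact ih a ha (ha.trans hi)

/-- The sequences of length below `κ` whose `β`-th value is an ordinal below `w β`. -/
def nodes (κ : Cardinal.{u}) (w : Ordinal.{u} → Ordinal.{u}) : Set TSeq.{u} :=
  {t | t.len < κ.ord ∧ ∀ β < t.len, ∃ i < w β, t.app β = i.toZFSet}

theorem restrict_mem_nodes {κ : Cardinal.{u}} {w : Ordinal.{u} → Ordinal.{u}} {t : TSeq.{u}}
    (ht : t ∈ nodes κ w) (α : Ordinal.{u}) : t.restrict α ∈ nodes κ w := by
  refine ⟨(min_le_left _ _).trans_lt ht.1, fun β hβ => ?_⟩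
  rw [TSeq.app_restrict _ (lt_of_lt_of_le hβ (min_le_right _ _))]
  exact ht.2 β (lt_of_lt_of_le hβ (min_le_left _ _))

theorem mem_nodes_of_le {κ : Cardinal.{u}} {w : Ordinal.{u} → Ordinal.{u}} {s t : TSeq.{u}}
    (ht : t ∈ nodes κ w) (h : s ≤ t) : s ∈ nodes κ w := by
  rw [← TSeq.restrict_len_of_le h]; exact restrict_mem_nodes ht _

theorem power_lt_of_isInaccessible {κ a b : Cardinal.{u}} (hκ : κ.IsInaccessible) (ha : a < κ)
    (hb : b < κ) : a ^ b < κ :=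
  calc a ^ b ≤ (2 ^ a) ^ b := power_le_power_right (cantor a).le
    _ = 2 ^ (a * b) := (power_mul).symm
    _ < κ := hκ.isStrongPrelimit (mul_lt_of_lt hκ.aleph0_lt.le ha hb)

theorem mk_Iio_lt {κ : Cardinal.{u}} {α : Ordinal.{u}} (hα : α < κ.ord) :
    #(Iio α) < lift.{u + 1} κ := by
  rw [Cardinal.mk_Iio_ordinal, lift_lt]; exact lt_ord.1 hα

theorem iSup_lt_ord_of_small {κ : Cardinal.{u}} (hκ : κ.IsInaccessible) {ι : Type (u + 1)}
    (hι : #ι < lift.{u + 1} κ) {f : ι → Ordinal.{u}} (hf : ∀ i, f i < κ.ord) :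
    ⨆ i, f i < κ.ord := by
  apply Ordinal.lift_iSup_lt_of_lt_cof _ hf
  rw [← Ordinal.lift_cof, hκ.isRegular.cof_ord, lift_id'.{u, u + 1}]
  exact hι

theorem bddAbove_of_small_index {κ : Cardinal.{u}} {ι : Type (u + 1)} {f : ι → Ordinal.{u}}
    (hf : ∀ i, f i < κ.ord) : BddAbove (range f) :=
  ⟨κ.ord, by rintro _ ⟨i, rfl⟩; exact (hf i).le⟩

/-- By regularity a single `v < κ` bounds all values, so the level injects into the functions from
`α` to `v`; these are fewer than `κ` since `κ` is a strong limit. -/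
theorem mk_seqLevel_nodes_lt {κ : Cardinal.{u}} (hκ : κ.IsInaccessible)
    {w : Ordinal.{u} → Ordinal.{u}} (hw : ∀ β < κ.ord, w β < κ.ord) {α : Ordinal.{u}}
    (hα : α < κ.ord) : #(seqLevel (nodes κ w) α) < lift.{u + 1} κ := by
  have hf : ∀ β : Iio α, w β < κ.ord := fun β => hw _ (lt_trans β.2 hα)
  set v : Ordinal.{u} := ⨆ β : Iio α, w β with hv
  have hvκ : v < κ.ord := iSup_lt_ord_of_small hκ (mk_Iio_lt hα) hf
  have hmem : ∀ t : seqLevel (nodes κ w) α, ∀ β : Iio α,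
      t.1.app β ∈ Ordinal.toZFSet '' Iio v := by
    rintro ⟨t, ht, rfl⟩ β
    obtain ⟨i, hi, h⟩ := ht.2 β β.2
    exact ⟨i, hi.trans_le (le_ciSup (bddAbove_of_small_index hf) β), h.symm⟩
  have hinj : Function.Injective fun (t : seqLevel (nodes κ w) α) (β : Iio α) =>
      (⟨t.1.app β, hmem t β⟩ : (Ordinal.toZFSet '' Iio v : Set ZFSet.{u})) := by
    intro s t hst
    refine Subtype.ext (TSeq.ext_app (s.2.2.trans t.2.2.symm) fun β hβ => ?_)
    exact congrArg Subtype.val (congrFun hst ⟨β, hβ.trans_eq s.2.2⟩)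
  refine (mk_le_of_injective hinj).trans_lt ?_
  rw [← power_def, mk_image_eq Ordinal.toZFSet_injective, Cardinal.mk_Iio_ordinal,
    Cardinal.mk_Iio_ordinal, ← lift_power, lift_lt]
  exact power_lt_of_isInaccessible hκ (lt_ord.1 hvκ) (lt_ord.1 hα)

theorem isStreamlined_nodes {κ : Cardinal.{u}} (hκ : κ.IsInaccessible)
    {w : Ordinal.{u} → Ordinal.{u}} (hw : ∀ β < κ.ord, w β < κ.ord) (hpos : ∀ β, 0 < w β) :
    IsStreamlined κ (nodes κ w) where
  len_lt t ht := ht.1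
  val_mem := by
    rintro t ht ⟨β, hβ⟩
    obtain ⟨i, hi, h⟩ := ht.2 β hβ
    rw [← TSeq.app_of_lt hβ, h]
    exact toZFSet_mem_hereditary (hi.trans (hw _ (lt_trans hβ ht.1)))
  restrict_mem t ht α _ := restrict_mem_nodes ht α
  level_nonempty α hα :=
    ⟨TSeq.ofFun α fun _ => Ordinal.toZFSet 0,
      ⟨hα, fun β hβ => ⟨0, hpos β, TSeq.app_ofFun _ hβ⟩⟩, rfl⟩
  level_small α hα := mk_seqLevel_nodes_lt hκ hw hα

/-- Pairs of an ordinal below `m` and a subset of a small set `N` can be coded by the ordinals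
below some `v < κ`. -/
theorem exists_coding {κ : Cardinal.{u}} (hκ : κ.IsInaccessible) {m : Ordinal.{u}}
    (hm : m < κ.ord) {N : Set TSeq.{u}} (hN : #N < lift.{u + 1} κ) :
    ∃ (v : Ordinal.{u}) (E : ZFSet.{u} → Set TSeq.{u} → ZFSet.{u}), v < κ.ord ∧ 0 < v ∧
      (∀ i < m, ∀ X, ∃ c < v, E i.toZFSet X = c.toZFSet) ∧
      ∀ i < m, ∀ j < m, ∀ X Y, E i.toZFSet X = E j.toZFSet Y →
        i = j ∧ ∀ x ∈ N, x ∈ X ↔ x ∈ Y := by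
  classical
  obtain ⟨c, hcκ, hc⟩ := lt_lift_iff.1 hN
  set d := m.card * 2 ^ c with hd
  have hdκ : d < κ := mul_lt_of_lt hκ.aleph0_lt.le (lt_ord.1 hm) (hκ.isStrongPrelimit hcκ)
  have hcard : #(Iio m × Set N) = #(Iio d.ord) := by
    rw [Cardinal.mk_Iio_ordinal, card_ord, hd, mk_prod, lift_id, lift_id, mk_set, ← hc,
      Cardinal.mk_Iio_ordinal, lift_mul, lift_power, lift_two]
  obtain ⟨φ⟩ := Cardinal.eq.1 hcard
  have hlim : Order.IsSuccLimit κ.ord := isSuccLimit_ord hκ.aleph0_lt.le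
  have hdo : d.ord < κ.ord := ord_lt_ord.2 hdκ
  -- The successor keeps the bound positive even when `d` is zero; `∅` is a default value for sets
  -- that are not ordinals below `m`.
  refine ⟨d.ord + 1, fun z X => if h : ∃ i < m, z = i.toZFSet then
    (φ (⟨h.choose, h.choose_spec.1⟩, {x | x.1 ∈ X})).1.toZFSet else ∅,
    hlim.add_one_lt hdo, by simp, ?_, ?_⟩
  · intro i hi X
    have h : ∃ j < m, i.toZFSet = j.toZFSet := ⟨i, hi, rfl⟩
    simp only [dif_pos h]
    exact ⟨_, lt_trans (φ _).2 (Order.lt_add_one_iff.2 le_rfl), rfl⟩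
  · intro i hi j hj X Y hXY
    have h : ∃ k < m, i.toZFSet = k.toZFSet := ⟨i, hi, rfl⟩
    have h' : ∃ k < m, j.toZFSet = k.toZFSet := ⟨j, hj, rfl⟩
    simp only [dif_pos h, dif_pos h'] at hXY
    have h1 := φ.injective (Subtype.ext (Ordinal.toZFSet_injective hXY))
    have h2 : h.choose = h'.choose := congrArg (fun p => p.1.1) h1
    have e := h.choose_spec.2
    rw [h2, ← h'.choose_spec.2] at e
    refine ⟨Ordinal.toZFSet_injective e, fun x hx => ?_⟩
    exact Set.ext_iff.1 (congrArg Prod.snd h1) ⟨x, hx⟩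

/-- The bound on the values of nodes: `max{ω, β}` at position `β`. -/
noncomputable def prolificBound (β : Ordinal.{u}) : Ordinal.{u} := max Ordinal.omega0 β

theorem prolificBound_lt {κ : Cardinal.{u}} (hκ : κ.IsInaccessible) :
    ∀ β < κ.ord, prolificBound β < κ.ord := by
  intro β hβ
  refine max_lt ?_ hβ
  rw [← ord_aleph0]; exact ord_lt_ord.2 hκ.aleph0_lt

/-- A uniform form of the diamond for trees: it guesses nodes together with subsets of the tree,
and the club depends on neither. -/
theorem DiamondStarTrees.exists_guess {κ : Cardinal.{u}} (hκ : κ.IsInaccessible)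
    {S : Set Ordinal.{u}} (h : DiamondStarTrees κ S (Iio κ.ord)) :
    ∃ (F : Ordinal.{u} → TSeq.{u}) (G : Ordinal.{u} → Set TSeq.{u}) (D : Set Ordinal.{u}),
      IsClubIn D κ.ord ∧ ∀ α ∈ S ∩ D, ∀ t ∈ seqLevel (nodes κ prolificBound) α,
        ∀ U : Set TSeq.{u}, IsStationaryIn {β | β < α ∧ t.restrict β = F β ∧
          ∀ x ∈ nodes κ prolificBound, x.len < β → (x ∈ G β ↔ x ∈ U)} α := by
  obtain ⟨f, hf⟩ := h
  have hcode := fun γ (hγ : γ < κ.ord) => exists_coding hκ (prolificBound_lt hκ γ hγ)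
    (mk_seqLevel_nodes_lt hκ (prolificBound_lt hκ) hγ)
  have : Nonempty (ZFSet.{u} → Set TSeq.{u} → ZFSet.{u}) := ⟨fun _ _ => ∅⟩
  choose! w₀ E hw hpos hval hinj using hcode
  -- The value 1 from `κ` on only serves to make `w` positive everywhere.
  set w : Ordinal.{u} → Ordinal.{u} := fun γ => if γ < κ.ord then w₀ γ else 1 with hwdef
  have hwlt : ∀ γ < κ.ord, w γ < κ.ord := fun γ hγ => by simpa [hwdef, hγ] using hw γ hγ
  have hwpos : ∀ γ, 0 < w γ := fun γ => by
    by_cases hγ : γ < κ.ord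
    · simpa [hwdef, hγ] using hpos γ hγ
    · simp [hwdef, hγ]
  -- Position `γ` records the value of `t` at `γ` and the trace of `U` on level `γ`, so a code of
  -- length `β` determines `U` on all nodes shorter than `β`.
  let code : TSeq.{u} → Set TSeq.{u} → TSeq.{u} := fun t U =>
    TSeq.ofFun t.len fun γ => E γ (t.app γ) U
  have hcode_app : ∀ t U, ∀ γ < t.len, (code t U).app γ = E γ (t.app γ) U :=
    fun t U γ hγ => TSeq.app_ofFun _ hγ
  have hcode_mem : ∀ t ∈ nodes κ prolificBound, ∀ U, code t U ∈ nodes κ w := by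
    intro t ht U
    refine ⟨ht.1, fun γ hγ => ?_⟩
    obtain ⟨i, hi, h⟩ := ht.2 γ hγ
    obtain ⟨c, hc, h'⟩ := hval γ (lt_trans hγ ht.1) i hi U
    refine ⟨c, by simpa [hwdef, lt_trans hγ ht.1] using hc, ?_⟩
    rw [hcode_app t U γ hγ, h, h']
  have hcode_inj : ∀ s ∈ nodes κ prolificBound, ∀ t ∈ nodes κ prolificBound, ∀ U V,
      code s U = code t V → s = t ∧
        ∀ x ∈ nodes κ prolificBound, x.len < s.len → (x ∈ U ↔ x ∈ V) := by
    intro s hs t ht U V he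
    have hl : s.len = t.len := congrArg TSeq.len (a₁ := code s U) (a₂ := code t V) he
    have key : ∀ γ < s.len, s.app γ = t.app γ ∧
        ∀ x ∈ seqLevel (nodes κ prolificBound) γ, x ∈ U ↔ x ∈ V := by
      intro γ hγ
      have h1 : (code s U).app γ = (code t V).app γ := by rw [he]
      rw [hcode_app _ _ _ hγ, hcode_app _ _ _ (hγ.trans_eq hl)] at h1
      obtain ⟨i, hi, h2⟩ := hs.2 γ hγ
      obtain ⟨j, hj, h3⟩ := ht.2 γ (hγ.trans_eq hl)
      rw [h2, h3] at h1
      obtain ⟨h4, h5⟩ := hinj γ (lt_trans hγ hs.1) i hi j hj U V h1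
      exact ⟨by rw [h2, h3, h4], h5⟩
    exact ⟨TSeq.ext_app hl fun γ hγ => (key γ hγ).1, fun x hx hxl => (key _ hxl).2 x ⟨hx, rfl⟩⟩
  have hdec : ∀ β, ∃ p : TSeq.{u} × Set TSeq.{u},
      (∃ t ∈ nodes κ prolificBound, ∃ U, code t U = f β) →
        p.1 ∈ nodes κ prolificBound ∧ code p.1 p.2 = f β := by
    intro β
    by_cases hβ : ∃ t ∈ nodes κ prolificBound, ∃ U, code t U = f β
    · obtain ⟨t, ht, U, hU⟩ := hβ
      exact ⟨(t, U), fun _ => ⟨ht, hU⟩⟩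
    · exact ⟨(f β, ∅), fun h => absurd h hβ⟩
  choose p hp using hdec
  -- All codes live in this one tree, so `D` is fixed before `t` and `U` are chosen.
  obtain ⟨D, hD, hguess⟩ := hf _ (isStreamlined_nodes hκ hwlt hwpos)
  refine ⟨fun β => (p β).1, fun β => (p β).2, D, hD, fun α hα t ht U => ?_⟩
  have hst := hguess α hα (code t U) ⟨hcode_mem t ht.1 U, ht.2⟩
  refine ⟨fun β hβ => hβ.1, hst.2.mono ?_⟩
  rintro ⟨β, hβα⟩ ⟨-, hβ⟩
  have hβα : β < α := hβα
  have hlen : (t.restrict β).len = β := TSeq.len_restrict_of_le (hβα.le.trans_eq ht.2.symm)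
  -- Coding is positionwise and hence commutes with restriction, so a guess of the restricted code
  -- decodes to the restricted node.
  have hcr : (code t U).restrict β = code (t.restrict β) U := by
    refine TSeq.ext_app rfl fun γ hγ => ?_
    have h1 : γ < β := lt_of_lt_of_le hγ (min_le_right _ _)
    have h2 : γ < t.len := lt_of_lt_of_le hγ (min_le_left _ _)
    rw [TSeq.app_restrict _ h1, hcode_app t U γ h2, hcode_app (t.restrict β) U γ hγ,
      TSeq.app_restrict _ h1]
  rw [hcr] at hβ
  have hr := restrict_mem_nodes ht.1 β
  obtain ⟨h1, h2⟩ := hp β ⟨_, hr, U, hβ⟩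
  obtain ⟨h3, h4⟩ := hcode_inj _ h1 _ hr _ _ (h2.trans hβ.symm)
  refine ⟨hβα, h3.symm, fun x hx hxl => h4 x hx ?_⟩
  rw [h3, hlen]; exact hxl

/-! ## Climbing along a closed set -/

/-- If the supremum were not in `C α`, it would be a positive limit of elements of `C α` below `α`,
contradicting closedness. -/
theorem IsCSequence.sSup_mem {κ : Cardinal.{u}} {C : Ordinal.{u} → Set Ordinal.{u}}
    (hC : IsCSequence κ C) {α γ ξ : Ordinal.{u}} (hα : α < κ.ord) (hγ : γ ≤ α) (hξ : ξ ∈ C α)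
    (hξγ : ξ < γ) (hlt : sSup (C α ∩ Iio γ) < γ) : sSup (C α ∩ Iio γ) ∈ C α := by
  by_contra hp
  have hle := le_sSup_inter_Iio hξ hξγ
  have hξp : ξ < sSup (C α ∩ Iio γ) := hle.lt_of_ne fun h => hp (h ▸ hξ)
  refine hp ((hC α hα).2.1 _ (hlt.trans_le hγ) (pos_of_gt hξp) ?_)
  apply congrArg sSup
  ext c
  refine ⟨fun hc => ⟨hc.1, lt_trans hc.2 hlt⟩, fun hc => ⟨hc.1, ?_⟩⟩
  exact (le_sSup_inter_Iio hc.1 hc.2).lt_of_ne fun h => hp (h ▸ hc.1)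

/-- Beyond `ξ`, the sequence `t` passes from each element of `C` to the next one by `next`. -/
def Climbs (next : Ordinal.{u} → TSeq.{u} → TSeq.{u}) (C : Set Ordinal.{u}) (ξ : Ordinal.{u})
    (t : TSeq.{u}) : Prop :=
  ∀ γ ∈ nacc C, ξ < γ → γ ≤ t.len → t.restrict γ = next γ (t.restrict (sSup (C ∩ Iio γ)))

theorem mem_nacc_or_unbounded {C : Set Ordinal.{u}} {γ : Ordinal.{u}} (h : γ ∈ C) :
    γ ∈ nacc C ∨ ∀ δ < γ, ∃ c ∈ C, δ < c ∧ c < γ := by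
  by_cases hγ : γ ∈ acc C
  · exact Or.inr (mem_acc.1 hγ).2.1
  · exact Or.inl ⟨h, hγ⟩

theorem notMem_nacc_of_unbounded {C : Set Ordinal.{u}} {γ : Ordinal.{u}} (h0 : 0 < γ)
    (h : ∀ δ < γ, ∃ c ∈ C, δ < c ∧ c < γ) : γ ∉ nacc C :=
  fun hn => hn.2 (mem_acc.2 ⟨hn.1, h, h0⟩)

/-- A node of length `ξ` climbs in at most one way. -/
theorem Climbs.restrict_eq {κ : Cardinal.{u}} {C : Ordinal.{u} → Set Ordinal.{u}}
    (hC : IsCSequence κ C) {α ξ : Ordinal.{u}} (hα : α < κ.ord) (hξ : ξ ∈ C α)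
    {next : Ordinal.{u} → TSeq.{u} → TSeq.{u}} {x s t : TSeq.{u}} (hx : x.len = ξ)
    (hs : Climbs next (C α) ξ s) (ht : Climbs next (C α) ξ t) (hxs : x ≤ s) (hxt : x ≤ t)
    {δ : Ordinal.{u}} (hξδ : ξ ≤ δ) (hδ : δ ∈ C α) (hδs : δ ≤ s.len)
    (hδt : δ ≤ t.len) : s.restrict δ = t.restrict δ := by
  induction δ using WellFoundedLT.induction with
  | ind δ ih =>
    rcases hξδ.eq_or_lt with rfl | hlt
    · rw [← hx, TSeq.restrict_len_of_le hxs, TSeq.restrict_len_of_le hxt]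
    have hδ0 : 0 < δ := pos_of_gt hlt
    rcases mem_nacc_or_unbounded hδ with hn | hu
    · have hp := sSup_inter_Iio_lt_of_mem_nacc hn hδ0
      rw [hs δ hn hlt hδs, ht δ hn hlt hδt]
      congr 1
      exact ih _ hp (le_sSup_inter_Iio hξ hlt)
        (hC.sSup_mem hα ((hC α hα).1 hδ).le hξ hlt hp) (hp.le.trans hδs) (hp.le.trans hδt)
    · refine TSeq.eq_of_restrict_eq ?_ fun ε hε => ?_
      · rw [TSeq.len_restrict_of_le hδs, TSeq.len_restrict_of_le hδt]
      rw [TSeq.len_restrict_of_le hδs] at hε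
      obtain ⟨c, hc, h1, h2⟩ := hu _ (max_lt hε hlt)
      refine ⟨c, (le_max_left _ _).trans_lt h1, ?_⟩
      rw [TSeq.restrict_restrict _ h2.le, TSeq.restrict_restrict _ h2.le]
      exact ih c h2 ((le_max_right _ _).trans h1.le) hc (h2.le.trans hδs) (h2.le.trans hδt)

/-! ## The tree -/

/-- `t` properly extends an element of `G`. -/
def Meets (G : Set TSeq.{u}) (t : TSeq.{u}) : Prop := ∃ u ∈ G, u < t

instance : Nonempty TSeq.{u} := ⟨TSeq.ofFun 0 fun _ => ∅⟩

/-- An extension of `y` in `N` that properly extends an element of `G`, if possible. -/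
noncomputable def nextNode (G N : Set TSeq.{u}) (y : TSeq.{u}) : TSeq.{u} :=
  Classical.epsilon fun z => z ∈ N ∧ y ≤ z ∧ ((∃ w ∈ N, y ≤ w ∧ Meets G w) → Meets G z)

theorem nextNode_spec {G N : Set TSeq.{u}} {y : TSeq.{u}} (h : ∃ w ∈ N, y ≤ w) :
    nextNode G N y ∈ N ∧ y ≤ nextNode G N y ∧
      ((∃ w ∈ N, y ≤ w ∧ Meets G w) → Meets G (nextNode G N y)) := by
  apply Classical.epsilon_spec (p := fun z =>
    z ∈ N ∧ y ≤ z ∧ ((∃ w ∈ N, y ≤ w ∧ Meets G w) → Meets G z))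
  by_cases hm : ∃ w ∈ N, y ≤ w ∧ Meets G w
  · obtain ⟨w, h1, h2, h3⟩ := hm
    exact ⟨w, h1, h2, fun _ => h3⟩
  · obtain ⟨w, h1, h2⟩ := h
    exact ⟨w, h1, h2, fun h => absurd h hm⟩

section Tree

variable (κ : Cardinal.{u}) (C : Ordinal.{u} → Set Ordinal.{u}) (F : Ordinal.{u} → TSeq.{u})
  (G : Ordinal.{u} → Set TSeq.{u})

/-- The levels of the tree. At a limit `α` every branch gets an upper bound, except for `F α` in
case that it avoids `G α` and that it does not climb along `C α`. -/
def fullLevel (α : Ordinal.{u}) : Set TSeq.{u} :=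
  {t | t ∈ seqLevel (nodes κ prolificBound) α ∧ (∀ β (_ : β < α), t.restrict β ∈ fullLevel β) ∧
    (Order.IsSuccLimit α → t = F α → Meets (G α) t ∨ ∃ ξ < α, ∀ γ (_ : γ < α), γ ∈ nacc (C α) →
      ξ < γ → t.restrict γ =
        nextNode (G γ) (fullLevel γ) (t.restrict (sSup (C α ∩ Iio γ))))}
termination_by α

/-- The function that leads from one node of a climbing branch to the next one. -/
noncomputable def fullNext (γ : Ordinal.{u}) (y : TSeq.{u}) : TSeq.{u} :=
  nextNode (G γ) (fullLevel κ C F G γ) y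

variable {κ C F G}

theorem mem_fullLevel {α : Ordinal.{u}} {t : TSeq.{u}} : t ∈ fullLevel κ C F G α ↔
    t ∈ seqLevel (nodes κ prolificBound) α ∧ (∀ β < α, t.restrict β ∈ fullLevel κ C F G β) ∧
    (Order.IsSuccLimit α → t = F α → Meets (G α) t ∨ ∃ ξ < α, ∀ γ < α, γ ∈ nacc (C α) →
      ξ < γ → t.restrict γ = fullNext κ C F G γ (t.restrict (sSup (C α ∩ Iio γ)))) := by
  conv_lhs => rw [fullLevel]
  rfl

theorem len_of_mem_fullLevel {α : Ordinal.{u}} {t : TSeq.{u}} (h : t ∈ fullLevel κ C F G α) :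
    t.len = α := (mem_fullLevel.1 h).1.2

theorem mem_nodes_of_mem_fullLevel {α : Ordinal.{u}} {t : TSeq.{u}}
    (h : t ∈ fullLevel κ C F G α) : t ∈ nodes κ prolificBound := (mem_fullLevel.1 h).1.1

theorem restrict_mem_fullLevel {α β : Ordinal.{u}} {t : TSeq.{u}} (h : t ∈ fullLevel κ C F G α)
    (hβ : β ≤ α) : t.restrict β ∈ fullLevel κ C F G β := by
  rcases hβ.eq_or_lt with rfl | hlt
  · rwa [TSeq.restrict_of_le (len_of_mem_fullLevel h).le]
  · exact (mem_fullLevel.1 h).2.1 β hlt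

theorem mem_fullLevel_of_le {α : Ordinal.{u}} {s t : TSeq.{u}} (h : t ∈ fullLevel κ C F G α)
    (hs : s ≤ t) : s ∈ fullLevel κ C F G s.len := by
  rw [← TSeq.restrict_len_of_le hs]
  have := restrict_mem_fullLevel h (hs.1.trans_eq (len_of_mem_fullLevel h))
  rwa [TSeq.len_restrict_of_le hs.1]

theorem concat_mem_fullLevel {α i : Ordinal.{u}} {t : TSeq.{u}} (h : t ∈ fullLevel κ C F G α)
    (hα : α + 1 < κ.ord) (hi : i < max Ordinal.omega0 α) :
    t.concat i.toZFSet ∈ fullLevel κ C F G (α + 1) := by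
  obtain rfl := len_of_mem_fullLevel h
  refine mem_fullLevel.2 ⟨⟨⟨hα, fun β hβ => ?_⟩, rfl⟩, fun β hβ => ?_, fun hlim => ?_⟩
  · rcases (Order.lt_add_one_iff.1 hβ).eq_or_lt with rfl | hlt
    · exact ⟨i, hi, TSeq.app_concat_len _ _⟩
    · rw [TSeq.app_concat_of_lt _ _ hlt]
      exact (mem_nodes_of_mem_fullLevel h).2 β hlt
  · have hβ' := Order.lt_add_one_iff.1 hβ
    rw [← TSeq.restrict_mono_left (TSeq.le_concat t _) hβ']
    exact restrict_mem_fullLevel h hβ'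
  · exact absurd (hlim.add_one_lt (Order.lt_add_one_iff.2 le_rfl)) (lt_irrefl _)

theorem fullLevel_zero_nonempty (h : 0 < κ.ord) : (fullLevel κ C F G 0).Nonempty :=
  ⟨TSeq.ofFun 0 fun _ => ∅, mem_fullLevel.2 ⟨⟨⟨h, fun _ hβ => (not_lt_zero hβ).elim⟩, rfl⟩,
    fun _ hβ => (not_lt_zero hβ).elim, fun hlim => (hlim.1 isMin_bot).elim⟩⟩

/-- Every node on `C α` climbs along `C α` to a node of level `α`. -/
theorem exists_climbs (hC : IsCSequence κ C) (hcoh : IsCoherent κ AlmostInitialIn C)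
    {α ξ : Ordinal.{u}} (hα : α < κ.ord)
    (hnormal : ∀ β < α, ∀ γ ≤ β, ∀ x ∈ fullLevel κ C F G γ, ∃ y ∈ fullLevel κ C F G β, x ≤ y)
    (hξ : ξ ∈ C α) {x : TSeq.{u}} (hx : x ∈ fullLevel κ C F G ξ) {δ : Ordinal.{u}} (hδα : δ ≤ α)
    (hξδ : ξ ≤ δ) (hδ : δ ∈ C α ∨ δ = α ∧ Order.IsSuccLimit α) :
    ∃ t ∈ fullLevel κ C F G δ, x ≤ t ∧ Climbs (fullNext κ C F G) (C α) ξ t := by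
  have hxl := len_of_mem_fullLevel hx
  induction δ using WellFoundedLT.induction with
  | ind δ ih =>
    rcases hξδ.eq_or_lt with rfl | hlt
    · exact ⟨x, hx, le_rfl, fun γ _ h1 h2 => absurd h1 (not_lt.2 (h2.trans_eq hxl))⟩
    have hδ0 : 0 < δ := pos_of_gt hlt
    have hcases : δ ∈ nacc (C α) ∨ ∀ ε < δ, ∃ c ∈ C α, ε < c ∧ c < δ := by
      rcases hδ with h | ⟨rfl, h⟩
      · exact mem_nacc_or_unbounded h
      · exact Or.inr (hC.unbounded hα h)
    rcases hcases with hn | hu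
    · have hδα' : δ < α := (hC α hα).1 hn.1
      have hp := sSup_inter_Iio_lt_of_mem_nacc hn hδ0
      obtain ⟨s, hs, hxs, hcs⟩ := ih _ hp (hp.le.trans hδα) (le_sSup_inter_Iio hξ hlt)
        (Or.inl (hC.sSup_mem hα hδα hξ hlt hp))
      have hsl := len_of_mem_fullLevel hs
      obtain ⟨h1, h2, -⟩ := nextNode_spec (G := G δ) (hnormal δ hδα' _ hp.le s hs)
      refine ⟨_, h1, hxs.trans h2, fun γ hγ hξγ hl => ?_⟩
      have hl' := len_of_mem_fullLevel h1
      rw [hl'] at hl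
      rcases hl.eq_or_lt with rfl | hγδ
      · rw [TSeq.restrict_of_le hl'.le, ← hsl, TSeq.restrict_len_of_le h2, fullNext]
      · have hγs : γ ≤ s.len := (le_sSup_inter_Iio hγ.1 hγδ).trans_eq hsl.symm
        rw [← TSeq.restrict_mono_left h2 hγs,
          ← TSeq.restrict_mono_left h2 ((sSup_inter_Iio_le _ _).trans hγs)]
        exact hcs γ hγ hξγ hγs
    -- At a limit of `C α` the climbing nodes above `x` form a chain, by uniqueness of climbs; their
    -- union is the required node.
    · let X : Set TSeq.{u} := {s | s.len ∈ C α ∧ ξ ≤ s.len ∧ s.len < δ ∧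
        s ∈ fullLevel κ C F G s.len ∧ x ≤ s ∧ Climbs (fullNext κ C F G) (C α) ξ s}
      have hXcof : ∀ ε < δ, ∃ s ∈ X, ε < s.len := by
        intro ε hε
        obtain ⟨c, hc, h1, h2⟩ := hu _ (max_lt hε hlt)
        have hξc : ξ ≤ c := (le_max_right _ _).trans h1.le
        obtain ⟨s, hs, hxs, hcs⟩ := ih c h2 (h2.le.trans hδα) hξc (Or.inl hc)
        obtain rfl := len_of_mem_fullLevel hs
        exact ⟨s, ⟨hc, hξc, h2, hs, hxs, hcs⟩, (le_max_left _ _).trans_lt h1⟩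
      have hXle : ∀ s ∈ X, ∀ r ∈ X, s.len ≤ r.len → s ≤ r := by
        rintro s ⟨h1, h2, -, -, h3, h4⟩ r ⟨-, -, -, -, h6, h7⟩ hsr
        have := h4.restrict_eq hC hα hξ hxl h7 h3 h6 h2 h1 le_rfl hsr
        rw [TSeq.restrict_of_le le_rfl] at this
        rw [this]; exact TSeq.restrict_le _ _
      obtain ⟨t, htl, hXt⟩ := TSeq.exists_union (α := δ) (X := X) (fun s hs => hs.2.2.1) hXcof
        fun s hs r hr => (le_total s.len r.len).imp (hXle s hs r hr) (hXle r hr s hs)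
      have hres : ∀ γ < δ, t.restrict γ ∈ fullLevel κ C F G γ := by
        intro γ hγ
        obtain ⟨s, hs, hγs⟩ := hXcof γ hγ
        rw [← TSeq.restrict_mono_left (hXt s hs) hγs.le]
        exact restrict_mem_fullLevel hs.2.2.2.1 hγs.le
      have hct : Climbs (fullNext κ C F G) (C α) ξ t := by
        intro γ hγ hξγ hl
        have hγδ : γ < δ := (hl.trans_eq htl).lt_of_ne fun h =>
          notMem_nacc_of_unbounded hδ0 hu (h ▸ hγ)
        obtain ⟨s, hs, hγs⟩ := hXcof γ hγδ
        have := hs.2.2.2.2.2 γ hγ hξγ hγs.le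
        rwa [TSeq.restrict_mono_left (hXt s hs) hγs.le,
          TSeq.restrict_mono_left (hXt s hs) ((sSup_inter_Iio_le _ _).trans hγs.le)] at this
      have hxt : x ≤ t := by
        obtain ⟨s, hs, -⟩ := hXcof 0 hδ0
        exact hs.2.2.2.2.1.trans (hXt s hs)
      refine ⟨t, mem_fullLevel.2 ⟨⟨⟨htl.trans_lt (hδα.trans_lt hα), fun β hβ => ?_⟩, htl⟩, hres,
        fun _ _ => Or.inr ?_⟩, hxt, hct⟩
      · obtain ⟨s, hs, hβs⟩ := hXcof β (hβ.trans_eq htl)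
        rw [← (TSeq.le_iff.1 (hXt s hs)).2 β hβs]
        exact (mem_nodes_of_mem_fullLevel hs.2.2.2.1).2 β hβs
      rcases hδα.eq_or_lt with rfl | hδα'
      · exact ⟨ξ, hlt, fun γ hγ hγn hξγ => hct γ hγn hξγ (hγ.le.trans_eq htl.symm)⟩
      -- Here `δ` is an accumulation point of `C α`, so `C δ` and `C α` have the same tail below
      -- `δ`, and the climb along `C α` protects the union at level `δ`.
      · have hδC : δ ∈ C α := hδ.resolve_right fun h => hδα'.ne h.1
        have hδκ : δ < κ.ord := hδα'.trans hα
        obtain ⟨ε, hε, hag⟩ := (hcoh α hα δ hδα' (mem_acc.2 ⟨hδC, hu, hδ0⟩)).exists_agree_nacc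
          (hC δ hδκ).1 (hC.unbounded hδκ (isSuccLimit_of_unbounded hδ0 hu))
        refine ⟨max ε ξ, max_lt hε hlt, fun γ hγ hγn hξγ => ?_⟩
        obtain ⟨h1, h2⟩ := hag γ hγ ((le_max_left _ _).trans_lt hξγ)
        rw [h2]
        exact hct γ (h1.1 hγn) ((le_max_right _ _).trans_lt hξγ) (hγ.le.trans_eq htl.symm)

/-- At successors append 0. At a limit `α`, first reach a level in `C α` by induction, then climb: a
climbing branch is never left out. -/
theorem exists_extension (hC : IsCSequence κ C)
    (hcoh : IsCoherent κ AlmostInitialIn C) {α : Ordinal.{u}} (hα : α < κ.ord) :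
    ∀ β ≤ α, ∀ x ∈ fullLevel κ C F G β, ∃ y ∈ fullLevel κ C F G α, x ≤ y := by
  induction α using WellFoundedLT.induction with
  | ind α ih =>
    intro β hβ x hx
    rcases hβ.eq_or_lt with rfl | hlt
    · exact ⟨x, hx, le_rfl⟩
    rcases Ordinal.zero_or_succ_or_isSuccLimit α with rfl | ⟨a, rfl⟩ | hlim
    · exact (not_lt_zero hlt).elim
    · have ha : a < a + 1 := Order.lt_add_one_iff.2 le_rfl
      obtain ⟨y, hy, hxy⟩ := ih a ha (ha.trans hα) β (Order.lt_add_one_iff.1 hlt) x hx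
      exact ⟨_, concat_mem_fullLevel (i := 0) hy hα
        (lt_max_of_lt_left Ordinal.omega0_pos), hxy.trans (TSeq.le_concat _ _)⟩
    · obtain ⟨ξ, hξ, hβξ, hξα⟩ := hC.unbounded hα hlim β hlt
      obtain ⟨y, hy, hxy⟩ := ih ξ hξα (hξα.trans hα) β hβξ.le x hx
      obtain ⟨t, ht, hyt, -⟩ := exists_climbs hC hcoh hα
        (fun β hβ => ih β hβ (hβ.trans hα)) hξ hy le_rfl hξα.le (Or.inr ⟨rfl, hlim⟩)
      exact ⟨t, ht, hxy.trans hyt⟩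

theorem fullLevel_nonempty (hC : IsCSequence κ C) (hcoh : IsCoherent κ AlmostInitialIn C)
    {α : Ordinal.{u}} (hα : α < κ.ord) : (fullLevel κ C F G α).Nonempty := by
  obtain ⟨x, hx⟩ := fullLevel_zero_nonempty (κ := κ) (C := C) (F := F) (G := G) (pos_of_gt hα)
  obtain ⟨y, hy, -⟩ := exists_extension hC hcoh hα 0 zero_le x hx
  exact ⟨y, hy⟩

variable (κ C F G) in
/-- The tree with levels `fullLevel κ C F G`. -/
def fullTree : Set TSeq.{u} := {t | t ∈ fullLevel κ C F G t.len}

theorem mem_fullTree_of_mem {α : Ordinal.{u}} {t : TSeq.{u}} (h : t ∈ fullLevel κ C F G α) :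
    t ∈ fullTree κ C F G := by
  obtain rfl := len_of_mem_fullLevel h; exact h

theorem seqLevel_fullTree (α : Ordinal.{u}) :
    seqLevel (fullTree κ C F G) α = fullLevel κ C F G α := by
  ext t
  refine ⟨?_, fun h => ⟨mem_fullTree_of_mem h, len_of_mem_fullLevel h⟩⟩
  rintro ⟨h, rfl⟩; exact h

theorem len_lt_of_mem_fullTree {t : TSeq.{u}} (h : t ∈ fullTree κ C F G) : t.len < κ.ord :=
  (mem_nodes_of_mem_fullLevel h).1

theorem mk_fullLevel_lt (hκ : κ.IsInaccessible) {α : Ordinal.{u}} (hα : α < κ.ord) :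
    #(fullLevel κ C F G α) < lift.{u + 1} κ :=
  (mk_le_mk_of_subset fun _ h => (mem_fullLevel.1 h).1).trans_lt
    (mk_seqLevel_nodes_lt hκ (prolificBound_lt hκ) hα)

/-! ## Dense sets are met at some level -/

/-- A monotone function bounding the lengths of the witnesses to the density of `U`. -/
theorem exists_density_bound (hκ : κ.IsInaccessible) (hC : IsCSequence κ C)
    (hcoh : IsCoherent κ AlmostInitialIn C) {U : Set TSeq.{u}} (hU : U ⊆ fullTree κ C F G)
    (hdense : ∀ x ∈ fullTree κ C F G, ∃ u ∈ U, x ≤ u) :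
    ∃ h : Ordinal.{u} → Ordinal.{u}, (∀ δ < κ.ord, h δ < κ.ord) ∧
      (∀ δ δ', δ ≤ δ' → δ' < κ.ord → h δ ≤ h δ') ∧
      ∀ x ∈ fullTree κ C F G, ∃ u ∈ U, x ≤ u ∧ u.len < h x.len := by
  -- Asking for all nodes of length at most `γ`, rather than exactly `γ`, makes the least element of
  -- `W γ` monotone in `γ`.
  let W : Ordinal.{u} → Set Ordinal.{u} := fun γ =>
    {γ' | ∀ x ∈ fullTree κ C F G, x.len ≤ γ → ∃ u ∈ U, x ≤ u ∧ u.len < γ'}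
  have hW : ∀ γ < κ.ord, ∃ γ' < κ.ord, γ' ∈ W γ := by
    intro γ hγ
    choose! u hu hxu using hdense
    have hlim : Order.IsSuccLimit κ.ord := isSuccLimit_ord hκ.aleph0_lt.le
    have hlt : ∀ x : fullLevel κ C F G γ, (u x).len + 1 < κ.ord := fun x =>
      hlim.add_one_lt (len_lt_of_mem_fullTree (hU (hu _ (mem_fullTree_of_mem x.2))))
    refine ⟨_, iSup_lt_ord_of_small hκ (mk_fullLevel_lt hκ hγ) hlt, fun x hx hxγ => ?_⟩
    -- A shorter node is first extended to level `γ`, so that a supremum over that one small level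
    -- suffices.
    obtain ⟨y, hy, hxy⟩ := exists_extension hC hcoh hγ _ hxγ x hx
    have hy' := mem_fullTree_of_mem hy
    refine ⟨u y, hu _ hy', hxy.trans (hxu _ hy'), ?_⟩
    exact (Order.lt_add_one_iff.2 le_rfl).trans_le
      (le_ciSup (bddAbove_of_small_index hlt) ⟨y, hy⟩)
  have hmem : ∀ γ < κ.ord, sInf (W γ) ∈ W γ := fun γ hγ => by
    obtain ⟨γ', -, h⟩ := hW γ hγ
    exact csInf_mem ⟨γ', h⟩
  refine ⟨fun γ => sInf (W γ), fun γ hγ => ?_, fun γ γ' hle hγ' => ?_, fun x hx => ?_⟩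
  · obtain ⟨γ', hlt, h⟩ := hW γ hγ
    exact (csInf_le' h).trans_lt hlt
  · exact csInf_le' fun x hx hxl => hmem γ' hγ' x hx (hxl.trans hle)
  · exact hmem _ (len_lt_of_mem_fullTree hx) x hx le_rfl

/-- Every dense subset of the tree is met by all the nodes of some level. -/
theorem exists_level_meets (hκ : κ.IsInaccessible) {S D : Set Ordinal.{u}}
    (hS : S ⊆ uncountableCof κ) (hSstat : IsStationaryIn S κ.ord) (hC : IsCSequence κ C)
    (hcoh : IsCoherent κ AlmostInitialIn C)
    (hproxy : ∀ B : Set Ordinal.{u}, IsCofinalIn B κ →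
      IsStationaryIn {α | α ∈ S ∧ sSup (nacc (C α) ∩ B) = α} κ.ord)
    (hD : IsClubIn D κ.ord)
    (hguess : ∀ α ∈ S ∩ D, ∀ t ∈ seqLevel (nodes κ prolificBound) α,
      ∀ U : Set TSeq.{u}, IsStationaryIn {β | β < α ∧ t.restrict β = F β ∧
        ∀ x ∈ nodes κ prolificBound, x.len < β → (x ∈ G β ↔ x ∈ U)} α)
    {U : Set TSeq.{u}} (hU : U ⊆ fullTree κ C F G)
    (hdense : ∀ x ∈ fullTree κ C F G, ∃ u ∈ U, x ≤ u) :
    ∃ α < κ.ord, ∀ t ∈ fullLevel κ C F G α, Meets U t := by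
  obtain ⟨h, hmap, hmono, hh⟩ := exists_density_bound hκ hC hcoh hU hdense
  have hκcof : ℵ₀ < κ.ord.cof := by rw [hκ.isRegular.cof_ord]; exact hκ.aleph0_lt
  have hκ0 : 0 < κ.ord := hκ.isRegular.ord_pos
  -- The good levels: `G γ` is correct about `U` below `γ`, and nodes shorter than `γ` have
  -- extensions in `U` shorter than `γ`.
  let B : Set Ordinal.{u} := {γ | γ < κ.ord ∧
    (∀ x ∈ nodes κ prolificBound, x.len < γ → (x ∈ G γ ↔ x ∈ U)) ∧ ∀ δ < γ, h δ < γ}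
  have hB : IsCofinalIn B κ := by
    refine ⟨fun γ hγ => hγ.1, fun η hη => ?_⟩
    obtain ⟨α, hαS, hαD, hακ, hηα, hα⟩ := hSstat.exists_closedUnder hD hκcof hη hmap hmono
    -- Any node of level `α` will do, as only the guess of `U` is needed here.
    obtain ⟨t, ht⟩ := fullLevel_nonempty (F := F) (G := G) hC hcoh hακ
    obtain ⟨β, hβ, -, hβα, hηβ, hβc⟩ :=
      (hguess α ⟨hαS, hαD⟩ t (mem_fullLevel.1 ht).1 U).exists_closedUnder (isClubIn_Iio α)
        (hS hαS).2 hηα (fun δ hδ => (hα δ hδ).1) fun δ δ' (h1 : δ ≤ δ') h2 => hmono δ δ' h1 (h2.trans hακ)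
    exact ⟨β, ⟨hβα.trans hακ, hβ.2.2, fun δ hδ => (hβc δ hδ).1⟩, hηβ.le⟩
  have hmeets : ∀ γ, ∀ t ∈ nodes κ prolificBound, t.len = γ →
      (∀ x ∈ nodes κ prolificBound, x.len < γ → (x ∈ G γ ↔ x ∈ U)) → Meets (G γ) t →
      Meets U t := by
    rintro _ t ht rfl hG ⟨u, hu, hut⟩
    exact ⟨u, (hG u (mem_nodes_of_le ht hut.le) (TSeq.len_lt hut)).1 hu, hut⟩
  obtain ⟨α, ⟨hαS, hαB⟩, hαD, hακ, hα0, -⟩ :=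
    (hproxy B hB).exists_closedUnder hD hκcof hκ0 (h := fun _ => 0) (fun _ _ => hκ0)
      fun _ _ _ _ => le_rfl
  refine ⟨α, hακ, fun t ht => ?_⟩
  have hBu : ∀ δ < α, ∃ c, c ∈ nacc (C α) ∩ B ∧ δ < c ∧ c < α := by
    have hsub : nacc (C α) ∩ B ⊆ Iio α := fun c hc => (hC α hακ).1 hc.1.1
    have := (sSup_inter_Iio_eq_iff (C := nacc (C α) ∩ B) (γ := α)).1
      (by rwa [inter_eq_self_of_subset_left hsub])
    exact this
  -- `k δ` is the next good point of `nacc (C α)` after `δ`; a `β` closed under `k` is a limit of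
  -- such points.
  let k : Ordinal.{u} → Ordinal.{u} := fun δ => sInf {c | c ∈ nacc (C α) ∩ B ∧ δ < c}
  have hk : ∀ δ < α, k δ ∈ {c | c ∈ nacc (C α) ∩ B ∧ δ < c} ∧ k δ < α := fun δ hδ => by
    obtain ⟨c, h1, h2, h3⟩ := hBu δ hδ
    exact ⟨csInf_mem ⟨c, h1, h2⟩, (csInf_le' (show c ∈ {c | c ∈ nacc (C α) ∩ B ∧ δ < c} from
      ⟨h1, h2⟩)).trans_lt h3⟩
  obtain ⟨β, ⟨-, htF, hGβ⟩, -, hβα, hβ0, hβ⟩ :=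
    (hguess α ⟨hαS, hαD⟩ t (mem_fullLevel.1 ht).1 U).exists_closedUnder (isClubIn_Iio α)
      (hS hαS).2 hα0 (h := k) (fun δ hδ => (hk δ hδ).2)
      fun δ δ' h1 h2 => csInf_le' (show k δ' ∈ {c | c ∈ nacc (C α) ∩ B ∧ δ < c} from
        ⟨(hk δ' h2).1.1, h1.trans_lt (hk δ' h2).1.2⟩)
  have hβu : ∀ δ < β, ∃ c, c ∈ nacc (C α) ∩ B ∧ δ < c ∧ c < β := fun δ hδ =>
    ⟨k δ, (hk δ (hδ.trans hβα)).1.1, (hk δ (hδ.trans hβα)).1.2, (hβ δ hδ).1⟩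
  have hβuC : ∀ δ < β, ∃ c ∈ C α, δ < c ∧ c < β := fun δ hδ => by
    obtain ⟨c, hc, h⟩ := hβu δ hδ
    exact ⟨c, hc.1.1, h⟩
  have hβlim := isSuccLimit_of_unbounded hβ0 hβuC
  have hβκ := hβα.trans hακ
  have htβ := restrict_mem_fullLevel ht hβα.le
  have hup : ∀ γ, Meets U (t.restrict γ) → Meets U t := fun γ ⟨u, hu, hlt⟩ =>
    ⟨u, hu, hlt.trans_le (TSeq.restrict_le t γ)⟩
  -- The restriction of `t` to `β` is `F β`, yet it belongs to the tree: one of the two reasons for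
  -- admission must hold.
  rcases (mem_fullLevel.1 htβ).2.2 hβlim htF with hm | ⟨ξ, hξ, hcl⟩
  · exact hup β (hmeets β _ (mem_nodes_of_mem_fullLevel htβ) (len_of_mem_fullLevel htβ) hGβ hm)
  have hβC : β ∈ C α := (hC α hακ).2.1 β hβα hβ0 (sSup_inter_Iio_eq_iff.2 hβuC)
  obtain ⟨ε, hε, hag⟩ := (hcoh α hακ β hβα (mem_acc.2 ⟨hβC, hβuC, hβ0⟩)).exists_agree_nacc
    (hC β hβκ).1 (hC.unbounded hβκ hβlim)
  -- A good point beyond both the start of the climb and the place from which `C β` agrees with `C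
  -- α`.
  obtain ⟨γ, ⟨hγn, hγκ, hGγ, hγh⟩, hlt, hγβ⟩ := hβu _ (max_lt hε hξ)
  have hγα := hγβ.trans hβα
  have hstep := hcl γ hγβ ((hag γ hγβ ((le_max_left _ _).trans_lt hlt)).1.2 hγn)
    ((le_max_right _ _).trans_lt hlt)
  rw [(hag γ hγβ ((le_max_left _ _).trans_lt hlt)).2, TSeq.restrict_restrict _ hγβ.le,
    TSeq.restrict_restrict _ ((sSup_inter_Iio_le _ _).trans hγβ.le)] at hstep
  have hp := sSup_inter_Iio_lt_of_mem_nacc hγn (pos_of_gt hlt)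
  have hy := restrict_mem_fullLevel ht (hp.trans hγα).le
  obtain ⟨u, hu, hyu, hul⟩ := hh _ (mem_fullTree_of_mem hy)
  rw [len_of_mem_fullLevel hy] at hul
  have huγ : u.len < γ := hul.trans (hγh _ hp)
  -- Density gives `u` in `U` below level `γ`, and `w` lifts it to level `γ`. So `nextNode` could
  -- meet `G γ` above the preceding node, and therefore it does.
  obtain ⟨w, hw, huw⟩ := exists_extension hC hcoh hγκ _ huγ.le u (hU hu)
  have huw' : u < w := huw.lt_of_ne fun h => huγ.ne (h ▸ len_of_mem_fullLevel hw)
  have hmw : Meets (G γ) w :=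
    ⟨u, (hGγ u (mem_nodes_of_mem_fullLevel (hU hu)) huγ).2 hu, huw'⟩
  have hmn := (nextNode_spec (G := G γ) ⟨w, hw, hyu.trans huw⟩).2.2 ⟨w, hw, hyu.trans huw, hmw⟩
  have htγ := restrict_mem_fullLevel ht hγα.le
  refine hup γ (hmeets γ _ (mem_nodes_of_mem_fullLevel htγ) (len_of_mem_fullLevel htγ) hGγ ?_)
  rw [hstep]; exact hmn

end Tree

/-! ## Heights -/

theorem eq_of_Iio_orderIso {a b : Ordinal.{u}} (h : Nonempty (Iio a ≃o Iio b)) : a = b := by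
  obtain ⟨e⟩ := h
  have := e.toRelIsoLT.ordinalType_congr
  have h1 := Ordinal.typein_ordinal a
  have h2 := Ordinal.typein_ordinal b
  exact Ordinal.lift_inj.1 (h1.symm.trans (this.trans h2))

/-- In a set closed under restriction, the predecessors of `x` are exactly its proper restrictions,
one for each smaller length. -/
theorem hasHeight_iff {T : Set TSeq.{u}} (hT : ∀ t ∈ T, ∀ α, t.restrict α ∈ T) {x : T}
    {α : Ordinal.{u}} : HasHeight x α ↔ x.1.len = α := by
  have e : Iio x ≃o Iio x.1.len :=
    { toFun := fun y => ⟨y.1.1.len, TSeq.len_lt y.2⟩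
      invFun := fun δ => ⟨⟨x.1.restrict δ.1, hT _ x.2 _⟩, TSeq.restrict_lt δ.2⟩
      left_inv := fun y => Subtype.ext (Subtype.ext (TSeq.restrict_len_of_le (le_of_lt y.2)))
      right_inv := fun δ => Subtype.ext (TSeq.len_restrict_of_le (le_of_lt δ.2))
      map_rel_iff' := fun {y z} =>
        ⟨fun h => TSeq.le_of_le_of_len (le_of_lt y.2) (le_of_lt z.2) h, fun h => TSeq.len_mono h⟩ }
  constructor
  · rintro ⟨e'⟩
    exact eq_of_Iio_orderIso ⟨e.symm.trans e'⟩
  · rintro rfl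
    exact ⟨e⟩

/-! ## Properties of the tree -/

section

variable {κ : Cardinal.{u}} {C : Ordinal.{u} → Set Ordinal.{u}} {F : Ordinal.{u} → TSeq.{u}}
  {G : Ordinal.{u} → Set TSeq.{u}}

theorem restrict_mem_fullTree {t : TSeq.{u}} (h : t ∈ fullTree κ C F G) (α : Ordinal.{u}) :
    t.restrict α ∈ fullTree κ C F G :=
  mem_fullLevel_of_le h (TSeq.restrict_le t α)

theorem hasHeight_fullTree {x : fullTree κ C F G} {α : Ordinal.{u}} :
    HasHeight x α ↔ x.1.len = α :=
  hasHeight_iff fun _ h => restrict_mem_fullTree h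

theorem concat_mem_fullTree (hκ : κ.IsInaccessible) {t : TSeq.{u}} (h : t ∈ fullTree κ C F G)
    {i : Ordinal.{u}} (hi : i < max Ordinal.omega0 t.len) :
    t.concat i.toZFSet ∈ fullTree κ C F G :=
  concat_mem_fullLevel h ((isSuccLimit_ord hκ.aleph0_lt.le).add_one_lt
    (len_lt_of_mem_fullTree h)) hi

theorem isStreamlined_fullTree (hκ : κ.IsInaccessible) (hC : IsCSequence κ C)
    (hcoh : IsCoherent κ AlmostInitialIn C) : IsStreamlined κ (fullTree κ C F G) where
  len_lt _ ht := len_lt_of_mem_fullTree ht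
  val_mem t ht := (isStreamlined_nodes hκ (prolificBound_lt hκ)
    fun _ => lt_max_of_lt_left Ordinal.omega0_pos).val_mem t (mem_nodes_of_mem_fullLevel ht)
  restrict_mem _ ht α _ := restrict_mem_fullTree ht α
  level_nonempty α hα := by
    rw [seqLevel_fullTree]; exact fullLevel_nonempty hC hcoh hα
  level_small α hα := by
    rw [seqLevel_fullTree]; exact mk_fullLevel_lt hκ hα

theorem isNormalTree_fullTree (hC : IsCSequence κ C) (hcoh : IsCoherent κ AlmostInitialIn C) :
    IsNormalTree κ (fullTree κ C F G) := by
  intro α hα β hβ x hx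
  have hxl : x.1.len = β := hasHeight_fullTree.1 hx
  obtain ⟨y, hy, hxy⟩ := exists_extension hC hcoh hα _ (hxl.trans_le hβ.le) x.1 x.2
  have hyl := len_of_mem_fullLevel hy
  refine ⟨⟨y, mem_fullTree_of_mem hy⟩, hasHeight_fullTree.2 hyl, ?_⟩
  exact Subtype.mk_lt_mk.2 (hxy.lt_of_ne fun h => hβ.ne (by rw [← hxl, h, hyl]))

theorem isProlific_fullTree (hκ : κ.IsInaccessible) : IsProlific κ (fullTree κ C F G) := by
  rintro _ - t ⟨ht, rfl⟩ i hi
  exact concat_mem_fullTree hκ ht hi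

/-- The only branch that may vanish at level `α` is the one given by `F α`. -/
theorem eq_of_isVanishing {α : Ordinal.{u}} (hα : α < κ.ord) (hlim : Order.IsSuccLimit α)
    {B : Set (fullTree κ C F G)} (hB : IsBranch B α) (hv : IsVanishing B) :
    B = {x | x.1.len < α ∧ x.1 ≤ F α} := by
  have hlen : ∀ x ∈ B, x.1.len < α := fun x hx => by
    obtain ⟨β, hβ, h⟩ := hB.height_lt x hx
    exact (hasHeight_fullTree.1 h).trans_lt hβ
  have hex : ∀ β < α, ∃ x ∈ B, x.1.len = β := fun β hβ => by
    obtain ⟨x, hx, h⟩ := hB.exists_height β hβ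
    exact ⟨x, hx, hasHeight_fullTree.1 h⟩
  obtain ⟨t, htl, ht⟩ := TSeq.exists_union (α := α) (X := Subtype.val '' B)
    (by rintro _ ⟨x, hx, rfl⟩; exact hlen x hx)
    (fun δ hδ => by
      obtain ⟨x, hx, h⟩ := hex _ (hlim.add_one_lt hδ)
      exact ⟨x, ⟨x, hx, rfl⟩, h ▸ Order.lt_add_one_iff.2 le_rfl⟩)
    (by
      rintro _ ⟨x, hx, rfl⟩ _ ⟨y, hy, rfl⟩
      exact hB.isChain.total hx hy)
  have hres : ∀ β < α, t.restrict β ∈ fullLevel κ C F G β := fun β hβ => by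
    obtain ⟨x, hx, rfl⟩ := hex β hβ
    rw [TSeq.restrict_len_of_le (ht _ ⟨x, hx, rfl⟩)]
    exact x.2
  have hnode : t ∈ nodes κ prolificBound := by
    refine ⟨htl.trans_lt hα, fun β hβ => ?_⟩
    have hβ' := hlim.add_one_lt (hβ.trans_eq htl)
    have hββ : β < β + 1 := Order.lt_add_one_iff.2 le_rfl
    rw [← TSeq.app_restrict t hββ]
    refine (mem_nodes_of_mem_fullLevel (hres _ hβ')).2 β ?_
    rwa [len_of_mem_fullLevel (hres _ hβ')]
  -- Otherwise the exclusion clause is vacuous for the union `t`, which would then be an upper bound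
  -- of the branch.
  have htF : t = F α := by
    by_contra hne
    have hmem : t ∈ fullLevel κ C F G α :=
      mem_fullLevel.2 ⟨⟨hnode, htl⟩, hres, fun _ h => absurd h hne⟩
    exact hv ⟨⟨t, mem_fullTree_of_mem hmem⟩, fun x hx => ht _ ⟨x, hx, rfl⟩⟩
  ext x
  refine ⟨fun hx => ⟨hlen x hx, htF ▸ ht _ ⟨x, hx, rfl⟩⟩, fun ⟨h1, h2⟩ => ?_⟩
  obtain ⟨y, hy, hyx⟩ := hex _ h1
  have hle := TSeq.le_of_le_of_len (ht _ ⟨y, hy, rfl⟩) (htF ▸ h2) hyx.le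
  rwa [← Subtype.ext (TSeq.eq_of_le_of_len hle hyx.ge)]

theorem isFull_fullTree : IsFull κ (fullTree κ C F G) := by
  intro α hα hlim B B' hB hv hB' hv'
  rw [eq_of_isVanishing hα hlim hB hv, eq_of_isVanishing hα hlim hB' hv']

theorem isKappaTree_fullTree (hκ : κ.IsInaccessible) (hC : IsCSequence κ C)
    (hcoh : IsCoherent κ AlmostInitialIn C) : IsKappaTree κ (fullTree κ C F G) where
  wellOrdered x := by
    obtain ⟨e⟩ := hasHeight_fullTree.2 (rfl : x.1.len = x.1.len)
    exact e.toRelIsoLT.toRelEmbedding.isWellOrder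
  level_nonempty α hα := by
    obtain ⟨t, ht⟩ := fullLevel_nonempty (F := F) (G := G) hC hcoh hα
    exact ⟨⟨t, mem_fullTree_of_mem ht⟩, hasHeight_fullTree.2 (len_of_mem_fullLevel ht)⟩
  level_small α hα := by
    rw [lift_id'.{u, u + 1}]
    refine lt_of_le_of_lt ?_ (mk_fullLevel_lt (C := C) (F := F) (G := G) hκ hα)
    refine mk_le_of_injective (f := fun x : level (fullTree κ C F G) α => ⟨x.1.1, ?_⟩) ?_
    · exact (congrArg (x.1.1 ∈ fullLevel κ C F G ·) (hasHeight_fullTree.1 x.2)).mp x.1.2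
    · intro x y h
      exact Subtype.ext (Subtype.ext (Subtype.mk.inj h))
  level_kappa := by
    refine eq_empty_of_forall_notMem fun x hx => ?_
    exact (len_lt_of_mem_fullTree x.2).ne (hasHeight_fullTree.1 hx)

/-- The nodes off a branch are dense, since two immediate successors of a node cannot both lie on
the branch. But a node on a `κ`-branch has all its predecessors on it, so it cannot extend a node
off it. -/
theorem no_branch_fullTree (hκ : κ.IsInaccessible)
    (hmeets : ∀ U ⊆ fullTree κ C F G, (∀ x ∈ fullTree κ C F G, ∃ u ∈ U, x ≤ u) →
      ∃ α < κ.ord, ∀ t ∈ fullLevel κ C F G α, Meets U t) :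
    ¬ ∃ B : Set (fullTree κ C F G), IsBranch B κ.ord := by
  rintro ⟨B, hB⟩
  obtain ⟨α, hα, hαU⟩ := hmeets {u | u ∈ fullTree κ C F G ∧ ∀ x ∈ B, x.1 ≠ u} (fun u hu => hu.1)
    (by
      intro x hx
      by_cases hxB : ∀ y ∈ B, y.1 ≠ x
      · exact ⟨x, ⟨hx, hxB⟩, le_rfl⟩
      have h0 := concat_mem_fullTree hκ hx (i := 0) (lt_max_of_lt_left Ordinal.omega0_pos)
      have h1 := concat_mem_fullTree hκ hx (i := 1) (lt_max_of_lt_left Ordinal.one_lt_omega0)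
      by_cases h : ∀ y ∈ B, y.1 ≠ x.concat (Ordinal.toZFSet 0)
      · exact ⟨_, ⟨h0, h⟩, TSeq.le_concat _ _⟩
      by_cases h' : ∀ y ∈ B, y.1 ≠ x.concat (Ordinal.toZFSet 1)
      · exact ⟨_, ⟨h1, h'⟩, TSeq.le_concat _ _⟩
      push Not at h h'
      obtain ⟨y, hy, hy0⟩ := h
      obtain ⟨z, hz, hz1⟩ := h'
      have hl : y.1.len = z.1.len := by rw [hy0, hz1]; rfl
      have hyz : y.1 = z.1 := (hB.isChain.total hy hz).elim
        (fun h => TSeq.eq_of_le_of_len h hl.ge) fun h => (TSeq.eq_of_le_of_len h hl.le).symm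
      have := congrArg (fun t => t.app x.len) (hy0.symm.trans (hyz.trans hz1))
      simp only [TSeq.app_concat_len] at this
      exact absurd (Ordinal.toZFSet_injective this) zero_ne_one)
  obtain ⟨b, hb, hbα⟩ := hB.exists_height α hα
  rw [hasHeight_fullTree] at hbα
  obtain ⟨u, ⟨-, hu⟩, hub⟩ := hαU b.1 (hbα ▸ b.2)
  have hul := TSeq.len_lt hub
  obtain ⟨y, hy, hyu⟩ := hB.exists_height u.len ((hul.trans_eq hbα).trans hα)
  rw [hasHeight_fullTree] at hyu
  have hyb : y.1 ≤ b.1 := (hB.isChain.total hy hb).resolve_right fun h =>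
    absurd (TSeq.len_mono h) (not_le.2 (hyu.trans_lt hul))
  exact hu y hy (TSeq.eq_of_le_of_len (TSeq.le_of_le_of_len hyb hub.le hyu.le) hyu.ge)

/-- The nodes that are above an element of `A` or below none are dense. No element of `A` properly
extends such a node, so `A` lies below the level `α` where this dense set is met. Extending its
elements to level `α` is injective, as two elements of `A` below one node are comparable. -/
theorem no_antichain_fullTree (hκ : κ.IsInaccessible) (hC : IsCSequence κ C)
    (hcoh : IsCoherent κ AlmostInitialIn C)
    (hmeets : ∀ U ⊆ fullTree κ C F G, (∀ x ∈ fullTree κ C F G, ∃ u ∈ U, x ≤ u) →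
      ∃ α < κ.ord, ∀ t ∈ fullLevel κ C F G α, Meets U t) :
    ¬ ∃ A : Set (fullTree κ C F G), IsAntichain (· ≤ ·) A ∧
      lift.{u} #A = lift.{u + 1} κ := by
  rintro ⟨A, hA, hcard⟩
  obtain ⟨α, hα, hαU⟩ := hmeets
    {u | u ∈ fullTree κ C F G ∧ ((∃ a ∈ A, a.1 ≤ u) ∨ ∀ a ∈ A, ¬ u ≤ a.1)} (fun u hu => hu.1)
    (by
      intro x hx
      by_cases h : ∃ a ∈ A, x ≤ a.1
      · obtain ⟨a, ha, hxa⟩ := h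
        exact ⟨a.1, ⟨a.2, Or.inl ⟨a, ha, le_rfl⟩⟩, hxa⟩
      · push Not at h
        exact ⟨x, ⟨hx, Or.inr h⟩, le_rfl⟩)
  have hlen : ∀ a ∈ A, a.1.len < α := by
    intro a ha
    by_contra! hle
    obtain ⟨u, ⟨-, hu⟩, hlt⟩ := hαU _ (restrict_mem_fullLevel a.2 hle)
    have hua := hlt.trans_le (TSeq.restrict_le a.1 α)
    rcases hu with ⟨a', ha', h⟩ | h
    · have := hA.eq ha' ha (h.trans hua.le)
      exact absurd hua (not_lt_of_ge (this ▸ h))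
    · exact h a ha hua.le
  have hext : ∀ a : A, ∃ y ∈ fullLevel κ C F G α, a.1.1 ≤ y := fun a =>
    exists_extension hC hcoh hα _ (hlen a.1 a.2).le _ a.1.2
  choose y hy hay using hext
  refine absurd hcard (ne_of_lt ?_)
  rw [lift_id'.{u, u + 1}]
  refine lt_of_le_of_lt ?_ (mk_fullLevel_lt (C := C) (F := F) (G := G) hκ hα)
  refine mk_le_of_injective (f := fun a : A => ⟨y a, hy a⟩) fun a b hab => Subtype.ext ?_
  have hab : y a = y b := congrArg Subtype.val hab
  rcases le_total a.1.1.len b.1.1.len with h | h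
  · exact hA.eq a.2 b.2 (TSeq.le_of_le_of_len (hay a) (hab ▸ hay b) h)
  · exact (hA.eq b.2 a.2 (TSeq.le_of_le_of_len (hay b) (hab ▸ hay a) h)).symm

end

theorem ProxyMinus.exists_cSequence {κ : Cardinal.{u}} {S : Set Ordinal.{u}}
    {R : Set Ordinal.{u} → Set Ordinal.{u} → Prop} (hS : S ⊆ uncountableCof κ)
    (h : ProxyMinus κ R 1 {S}) :
    ∃ C, IsCSequence κ C ∧ IsCoherent κ R C ∧ ∀ B : Set Ordinal.{u}, IsCofinalIn B κ →
      IsStationaryIn {α | α ∈ S ∧ sSup (nacc (C α) ∩ B) = α} κ.ord := by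
  obtain ⟨C, hC, hcoh, hhit⟩ := h
  refine ⟨C, hC, hcoh, fun B hB => ?_⟩
  obtain ⟨h1, h2⟩ := hhit (fun _ => B) (fun _ _ => hB) S rfl
  refine ⟨fun α hα => (hS hα.1).1, h2.mono ?_⟩
  rintro α ⟨hαS, hα⟩
  -- The index 0 is available because `α` is nonzero, having uncountable cofinality.
  refine ⟨hαS, hα 0 (lt_min ?_ (by simp))⟩
  exact (Ordinal.one_lt_cof_iff.1 (one_lt_aleph0.trans (hS hαS).2)).bot_lt

end FullSouslin

theorem mainTheorem6 (κ : Cardinal.{u}) (hκ : κ.IsInaccessible)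
    (S : Set Ordinal.{u}) (hS : S ⊆ FullSouslin.uncountableCof κ)
    (hSstat : FullSouslin.IsStationaryIn S κ.ord)
    (hdiamond : FullSouslin.DiamondStarTrees κ S (Set.Iio κ.ord))
    (hproxy : FullSouslin.ProxyMinus κ FullSouslin.AlmostInitialIn 1 {S}) :
    ∃ T : Set FullSouslin.TSeq.{u},
      FullSouslin.IsStreamlined κ T ∧
      FullSouslin.IsNormalTree κ T ∧
      FullSouslin.IsProlific κ T ∧
      FullSouslin.IsFull κ T ∧
      FullSouslin.IsSouslin κ T := by
  obtain ⟨C, hC, hcoh, hhit⟩ := hproxy.exists_cSequence hS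
  obtain ⟨F, G, D, hD, hguess⟩ := hdiamond.exists_guess hκ
  have hmeets := fun U hU hdense => FullSouslin.exists_level_meets (F := F) (G := G) hκ hS
    hSstat hC hcoh hhit hD hguess (U := U) hU hdense
  exact ⟨FullSouslin.fullTree κ C F G, FullSouslin.isStreamlined_fullTree hκ hC hcoh,
    FullSouslin.isNormalTree_fullTree hC hcoh, FullSouslin.isProlific_fullTree hκ,
    FullSouslin.isFull_fullTree, FullSouslin.isKappaTree_fullTree hκ hC hcoh,
    FullSouslin.no_branch_fullTree hκ hmeets,
    FullSouslin.no_antichain_fullTree hκ hC hcoh hmeets⟩
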